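/- Let $\Lambda$ be an artin algebra and $\operatorname{mod}\Lambda$ the category of $\Lambda$-modules of finite length; $|X|$ denotes the length of a module $X$. The Gabriel-Roiter measure $\mu$ is defined inductively by $\mu(0)=0$, $\mu(X)=\max_{X'\subsetneq X}\mu(X')$ if $X\neq 0$ is decomposable, and $\mu(X)=2^{-|X|}+\max_{X'\subsetneq X}\mu(X')$ if $X$ is indecomposable. A Gabriel-Roiter submodule of an indecomposable module $X$ is an indecomposable submodule $X'$ with $\mu(X)-\mu(X')=2^{-|X|}$, and then $X'\subset X$ is called a Gabriel-Roiter inclusion. A Gabriel-Roiter filtration of $X$ is a chain $X_1\subset X_2\subset\cdots\subset X_n=X$ of indecomposable submodules with $X_1$ simple such that all inclusions $X_{i-1}\subset X_i$ are Gabriel-Roiter inclusions. The Auslander-Reiten quiver of $\Lambda$ has as vertices the isomorphism classes $[X]$ of indecomposable modules in $\operatorname{mod}\Lambda$, with an arrow $[X]\to[Y]$ iff there is an irreducible map $X\to Y$, and with the translation $\tau[Z]=[X]$ whenever there is an Auslander-Reiten sequence $0\to X\to Y\to Z\to 0$. A homogeneous tube is a connected component $\mathcal T$ of this quiver which, as a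 translation quiver, is isomorphic to $\mathbb{Z}A_\infty/\tau$ (the vertices are the integers $t\ge 1$, the arrows are $t\to t+1$ and $t+1\to t$, and $\tau t=t$). Theorem B. Let $\mathcal T$ be a homogeneous tube, and for $t\ge 1$ let $M[t]$ be an indecomposable module whose class corresponds to the vertex $t$ under an isomorphism $\mathbb{Z}A_\infty/\tau\cong\mathcal T$. Then $M[1]$ is of smallest possible length in $\mathcal T$, and every $M[t]$ has a filtration with $t$ factors, all isomorphic to $M[1]$. Moreover, let $m\ge 2$. (a) In any Gabriel-Roiter filtration of $M[m]$, one of the submodules which occur is isomorphic to $M[1]$. (b) If $M[1]$ is a brick (that is, its endomorphism ring is a division ring), then $M[m]$ has a unique Gabriel-Roiter submodule, namely the unique submodule of $M[m]$ which is isomorphic to $M[m-1]$. -/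

import Mathlib

universe u

section Modules

variable (Λ : Type u) [Ring Λ]

/-- The length of a module, as a natural number (used for modules of finite length only). -/
noncomputable def len (X : Type u) [AddCommGroup X] [Module Λ X] : ℕ :=
  (Module.length Λ X).toNat

/-- A module is indecomposable if it is nonzero and has no nontrivial direct decomposition. -/
def IsIndec (X : Type u) [AddCommGroup X] [Module Λ X] : Prop :=
  Nontrivial X ∧ ∀ A B : Submodule Λ X, IsCompl A B → A = ⊥ ∨ B = ⊥

/-- A module is a brick if its endomorphism ring is a division ring. -/
def IsBrick (X : Type u) [AddCommGroup X] [Module Λ X] : Prop :=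
  Nontrivial (Module.End Λ X) ∧ ∀ f : Module.End Λ X, f ≠ 0 → IsUnit f

/-- `X` has a filtration with exactly `n` factors, all of them isomorphic to `Y`. -/
def HasFiltrationBy (X Y : Type u) [AddCommGroup X] [Module Λ X] [AddCommGroup Y] [Module Λ Y]
    (n : ℕ) : Prop :=
  ∃ F : Fin (n + 1) → Submodule Λ X, F 0 = ⊥ ∧ F (Fin.last n) = ⊤ ∧
    ∀ i : Fin n, F i.castSucc ≤ F i.succ ∧
      Nonempty ((↥(F i.succ) ⧸ (F i.castSucc).submoduleOf (F i.succ)) ≃ₗ[Λ] Y)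

end Modules

section GabrielRoiter

variable (Λ : Type u) [Ring Λ]

theorem len_submodule_lt (X : Type u) [AddCommGroup X] [Module Λ X]
    [IsNoetherian Λ X] [IsArtinian Λ X] (N : Submodule Λ X) (hN : N ≠ ⊤) :
    len Λ N < len Λ X := by
  have h : Module.length Λ N < Module.length Λ X := Submodule.length_lt hN
  rw [← ENat.natCast_toNat (Module.length_ne_top (R := Λ) (M := N)),
    ← ENat.natCast_toNat (Module.length_ne_top (R := Λ) (M := X))] at h
  exact_mod_cast h

open Classical in
/-- The Gabriel-Roiter measure of a module of finite length: the largest value on proper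
submodules, increased by `2 ^ (-|X|)` in case `X` is indecomposable. (Only finitely many values
occur, so the supremum is a maximum; for `X = 0` there is no proper submodule and the value
is `0`.) -/
noncomputable def grMeasure (X : Type u) [AddCommGroup X] [Module Λ X]
    [IsNoetherian Λ X] [IsArtinian Λ X] : ℝ :=
  (if IsIndec Λ X then (1 / 2 : ℝ) ^ len Λ X else 0) +
    ⨆ N : {N : Submodule Λ X // N ≠ ⊤}, grMeasure N.1
termination_by len Λ X
decreasing_by exact len_submodule_lt Λ X N.1 N.2

variable {Λ}

/-- Gabriel-Roiter submodules of an indecomposable module `X`. -/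
def IsGRSubmodule {X : Type u} [AddCommGroup X] [Module Λ X]
    [IsNoetherian Λ X] [IsArtinian Λ X] (N : Submodule Λ X) : Prop :=
  IsIndec Λ X ∧ IsIndec Λ N ∧ grMeasure Λ X - grMeasure Λ N = (1 / 2 : ℝ) ^ len Λ X

/-- `A ⊆ B` is a Gabriel-Roiter inclusion between submodules of a given module. -/
def IsGRInclusion {X : Type u} [AddCommGroup X] [Module Λ X]
    [IsNoetherian Λ X] [IsArtinian Λ X] (A B : Submodule Λ X) : Prop :=
  A ≤ B ∧ IsGRSubmodule (A.submoduleOf B)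

/-- A Gabriel-Roiter filtration `F 0 ⊂ F 1 ⊂ ⋯ ⊂ F n = X` of `X`. -/
structure IsGRFiltration {X : Type u} [AddCommGroup X] [Module Λ X]
    [IsNoetherian Λ X] [IsArtinian Λ X] {n : ℕ} (F : Fin (n + 1) → Submodule Λ X) : Prop where
  indec : ∀ i, IsIndec Λ (F i)
  simple : IsSimpleModule Λ (F 0)
  last : F (Fin.last n) = ⊤
  incl : ∀ i : Fin n, IsGRInclusion (F i.castSucc) (F i.succ)

end GabrielRoiter

section AuslanderReiten

variable (Λ : Type u) [Ring Λ]

/-- The objects of `mod Λ`: the `Λ`-modules of finite length. -/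
structure FLMod where
  carrier : Type u
  [addCommGroup : AddCommGroup carrier]
  [module : Module Λ carrier]
  [isNoetherian : IsNoetherian Λ carrier]
  [isArtinian : IsArtinian Λ carrier]

instance : CoeSort (FLMod Λ) (Type u) := ⟨FLMod.carrier⟩

attribute [instance] FLMod.addCommGroup FLMod.module FLMod.isNoetherian FLMod.isArtinian

/-- The indecomposable objects of `mod Λ`. -/
structure IndMod extends FLMod Λ where
  indec : IsIndec Λ carrier

instance : CoeSort (IndMod Λ) (Type u) := ⟨fun X => X.carrier⟩

variable {Λ}

/-- The radical of the category `mod Λ`. -/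
def radHom (X Y : FLMod Λ) : Set (X →ₗ[Λ] Y) :=
  {f | ∀ g : Y →ₗ[Λ] X, IsUnit (1 - g ∘ₗ f : Module.End Λ X)}

/-- The square of the radical of `mod Λ`: all finite sums of composites of two radical maps. -/
def radSqHom (X Y : FLMod Λ) : AddSubgroup (X →ₗ[Λ] Y) :=
  AddSubgroup.closure
    {h | ∃ Z : FLMod Λ, ∃ f ∈ radHom X Z, ∃ g ∈ radHom Z Y, h = g ∘ₗ f}

/-- Irreducible maps (between indecomposable modules): radical maps outside the square
of the radical. -/
def IsIrreducibleMap {X Y : IndMod Λ} (f : X →ₗ[Λ] Y) : Prop :=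
  f ∈ radHom X.toFLMod Y.toFLMod ∧ f ∉ radSqHom X.toFLMod Y.toFLMod

/-- A split monomorphism. -/
def IsSplitMonoMap {X Y : FLMod Λ} (f : X →ₗ[Λ] Y) : Prop :=
  ∃ r : Y →ₗ[Λ] X, r ∘ₗ f = LinearMap.id

/-- A split epimorphism. -/
def IsSplitEpiMap {X Y : FLMod Λ} (f : X →ₗ[Λ] Y) : Prop :=
  ∃ s : Y →ₗ[Λ] X, f ∘ₗ s = LinearMap.id

/-- `0 → X → Y → Z → 0` is an Auslander-Reiten (almost split) sequence in `mod Λ`: it is exact,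
the first map is left almost split and the second one is right almost split. -/
structure IsARSequence {X Y Z : FLMod Λ} (f : X →ₗ[Λ] Y) (g : Y →ₗ[Λ] Z) : Prop where
  injective : Function.Injective f
  exact : Function.Exact f g
  surjective : Function.Surjective g
  not_splitMono : ¬ IsSplitMonoMap f
  left_almost_split : ∀ (W : FLMod Λ) (h : X →ₗ[Λ] W), ¬ IsSplitMonoMap h →
    ∃ h' : Y →ₗ[Λ] W, h' ∘ₗ f = h
  not_splitEpi : ¬ IsSplitEpiMap g
  right_almost_split : ∀ (W : FLMod Λ) (h : W →ₗ[Λ] Z), ¬ IsSplitEpiMap h →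
    ∃ h' : W →ₗ[Λ] Y, g ∘ₗ h' = h

variable (Λ)

/-- Isomorphism of indecomposable modules. -/
instance IndMod.setoid : Setoid (IndMod Λ) where
  r X Y := Nonempty (X ≃ₗ[Λ] Y)
  iseqv :=
    { refl := fun X => ⟨LinearEquiv.refl Λ X⟩
      symm := fun ⟨e⟩ => ⟨e.symm⟩
      trans := fun ⟨e⟩ ⟨e'⟩ => ⟨e.trans e'⟩ }

/-- The vertices of the Auslander-Reiten quiver: isomorphism classes of indecomposables. -/
def ARVertex : Type (u + 1) := Quotient (IndMod.setoid Λ)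

variable {Λ}

/-- The isomorphism class `[X]`. -/
def IndMod.cls (X : IndMod Λ) : ARVertex Λ := Quotient.mk (IndMod.setoid Λ) X

/-- There is an arrow `[X] → [Y]` iff there exists an irreducible map `X → Y`. -/
def ARArrow (x y : ARVertex Λ) : Prop :=
  ∃ X Y : IndMod Λ, X.cls = x ∧ Y.cls = y ∧ ∃ f : X →ₗ[Λ] Y, IsIrreducibleMap f

/-- The Auslander-Reiten translation, as a relation: `[X] = τ [Z]` iff there is an
Auslander-Reiten sequence `0 → X → Y → Z → 0`. -/
def ARTau (x z : ARVertex Λ) : Prop :=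
  ∃ (X : IndMod Λ) (Y : FLMod Λ) (Z : IndMod Λ), X.cls = x ∧ Z.cls = z ∧
    ∃ (f : X.toFLMod →ₗ[Λ] Y) (g : Y →ₗ[Λ] Z.toFLMod), IsARSequence f g

/-- The (connected) components of the Auslander-Reiten quiver. -/
def IsARComponent (T : Set (ARVertex Λ)) : Prop :=
  ∃ x : ARVertex Λ, T = {y | Relation.EqvGen ARArrow x y}

end AuslanderReiten

section Tubes

/-- The arrows of the translation quiver `ℤA_∞`, whose vertex set is `ℤ × ℕ₁`:
`(i, t) → (i, t + 1)` and `(i, t + 1) → (i + 1, t)`. -/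
def ZAInfArrow (x y : ℤ × ℕ+) : Prop :=
  (y.1 = x.1 ∧ y.2 = x.2 + 1) ∨ (y.1 = x.1 + 1 ∧ x.2 = y.2 + 1)

/-- The translation of `ℤA_∞`. -/
def zAInfTau (x : ℤ × ℕ+) : ℤ × ℕ+ := (x.1 - 1, x.2)

/-- The arrows of the orbit quiver `ℤA_∞/τ`; the `τ`-orbits are the sets `ℤ × {t}`, so its vertex
set is `ℕ₁`. -/
def ZAInfModTauArrow (s t : ℕ+) : Prop := ∃ i j : ℤ, ZAInfArrow (i, s) (j, t)

/-- The translation of `ℤA_∞/τ`, as a relation: `s = τ t`. -/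
def ZAInfModTauTau (s t : ℕ+) : Prop := ∃ i j : ℤ, (i, s) = zAInfTau (j, t)

variable {Λ : Type u} [Ring Λ]

/-- `e` is an isomorphism of translation quivers from `ℤA_∞/τ` onto the full subquiver `T` of the
Auslander-Reiten quiver. -/
structure IsTubeIso {T : Set (ARVertex Λ)} (e : ℕ+ ≃ T) : Prop where
  arrow_iff : ∀ s t, ARArrow (e s).1 (e t).1 ↔ ZAInfModTauArrow s t
  tau_iff : ∀ s t, ARTau (e s).1 (e t).1 ↔ ZAInfModTauTau s t

/-- Homogeneous tubes: components of the Auslander-Reiten quiver of the form `ℤA_∞/τ`. -/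
def IsHomogeneousTube (T : Set (ARVertex Λ)) : Prop :=
  IsARComponent T ∧ ∃ e : ℕ+ ≃ T, IsTubeIso e

/-- The modules `M t` (`t ≥ 1`) are representatives of the vertices of `T`, indexed according to an
isomorphism `ℤA_∞/τ ≅ T`. -/
def IsTubeLabelling (T : Set (ARVertex Λ)) (M : ℕ+ → IndMod Λ) : Prop :=
  ∃ e : ℕ+ ≃ T, IsTubeIso e ∧ ∀ t, (M t).cls = (e t).1

end Tubes

/-!
No existence theorem for Auslander-Reiten sequences is needed: the tube provides one starting and
ending in each of its modules. Write `N t` for the module at the vertex `t + 1` and `ℓ` for the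
length of `N 0`. By the usual arguments with local endomorphism rings, both `N (t + 1)` and
`N (t - 1)` are direct summands of the middle term of the sequence for `N t`, and every
indecomposable summand is one of the two. Counting lengths shows that there is nothing else: the
lengths form a concave sequence of naturals without repetitions, so they increase strictly, and
this forces the sequence to be `0 → N t → N (t + 1) ⊕ N (t - 1) → N t → 0`, with
`|N t| = (t + 1) ℓ` (`IsTubeSeq.exists_mesh_and_len`).

Each irreducible map between neighbours is a component of such a sequence, that is, a side of a
bicartesian square, and parallel sides have isomorphic kernels and cokernels. By induction the maps
`N t → N (t + 1)` are injective with cokernel `N 0`, the maps `N (t + 1) → N t` are surjective with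
kernel `N 0`, and a module `V` with `|V| ≤ ℓ` and `V ≇ N 0` has the lifting property for the
latter (`IsTubeSeq.exists_lift`). The surjections give the filtration with factors `N 0`.

For (a), lifting shows that a submodule of `N t` of length at most `ℓ` is cogenerated by `N 0`. In a
Gabriel-Roiter filtration let `F i` be the largest term of length at most `ℓ`. Since `N 0` embeds
into `N t`, comparing the binary digits of the measures up to the `ℓ`-th one gives
`μ(F i) ≥ μ(N 0)`. Gabriel's main property (`exists_injective_of_jointly_injective`) then provides
an embedding `F i → N 0`, which is onto because proper submodules of `N 0` have smaller measure.

For (b), if `N 0` is a brick, then each `N t` has only one submodule isomorphic to `N 0`. Hence an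
embedding `N n → N (n + 1)` has to respect the filtrations by kernels of the surjections
`N n → N s` (`IsTubeSeq.map_tubeLayer`), which gives the uniqueness of the submodule isomorphic to
`N n`. By (a) a Gabriel-Roiter filtration contains the first of these kernels. If it contains the
`j`-th one, then its next term exceeds it by at most `ℓ`, by comparison with the measure of the
`(j + 1)`-st kernel. The image of this term in `N s` is then isomorphic to `N 0`, since otherwise
it would lift and split the indecomposable term; so the next term is the next kernel
(`IsTubeSeq.eq_tubeLayer_succ`).
-/

/-! ### Length and indecomposable modules -/

section Basics

variable {Λ : Type u} [Ring Λ]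
variable {X Y Z : Type u} [AddCommGroup X] [Module Λ X] [AddCommGroup Y] [Module Λ Y]
  [AddCommGroup Z] [Module Λ Z]

theorem len_eq_of_equiv (e : X ≃ₗ[Λ] Y) : len Λ X = len Λ Y := by
  simp only [len, e.length_eq]

theorem coe_len [IsNoetherian Λ X] [IsArtinian Λ X] :
    ((len Λ X : ℕ) : ℕ∞) = Module.length Λ X :=
  ENat.natCast_toNat Module.length_ne_top

theorem len_eq_add_of_exact [IsNoetherian Λ X] [IsArtinian Λ X] [IsNoetherian Λ Y]
    [IsArtinian Λ Y] [IsNoetherian Λ Z] [IsArtinian Λ Z] {f : X →ₗ[Λ] Y} {g : Y →ₗ[Λ] Z}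
    (hf : Function.Injective f) (hg : Function.Surjective g) (h : Function.Exact f g) :
    len Λ Y = len Λ X + len Λ Z := by
  have := Module.length_eq_add_of_exact f g hf hg h
  rw [← coe_len, ← coe_len, ← coe_len] at this
  exact_mod_cast this

theorem len_prod [IsNoetherian Λ X] [IsArtinian Λ X] [IsNoetherian Λ Y] [IsArtinian Λ Y] :
    len Λ (X × Y) = len Λ X + len Λ Y := by
  have := Module.length_prod Λ X Y
  rw [← coe_len, ← coe_len, ← coe_len] at this
  exact_mod_cast this

theorem len_le_of_injective [IsNoetherian Λ X] [IsArtinian Λ X] [IsNoetherian Λ Y]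
    [IsArtinian Λ Y] {f : X →ₗ[Λ] Y} (hf : Function.Injective f) : len Λ X ≤ len Λ Y := by
  have := Module.length_le_of_injective f hf
  rw [← coe_len, ← coe_len] at this
  exact_mod_cast this

theorem len_le_of_surjective [IsNoetherian Λ X] [IsArtinian Λ X] [IsNoetherian Λ Y]
    [IsArtinian Λ Y] {f : X →ₗ[Λ] Y} (hf : Function.Surjective f) : len Λ Y ≤ len Λ X := by
  have := Module.length_le_of_surjective f hf
  rw [← coe_len, ← coe_len] at this
  exact_mod_cast this

theorem len_eq_zero_iff [IsNoetherian Λ X] [IsArtinian Λ X] :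
    len Λ X = 0 ↔ Subsingleton X := by
  rw [← Module.length_eq_zero_iff (R := Λ), ← coe_len]
  norm_cast

theorem len_pos [IsNoetherian Λ X] [IsArtinian Λ X] [Nontrivial X] : 0 < len Λ X := by
  rw [Nat.pos_iff_ne_zero, Ne, len_eq_zero_iff]
  exact not_subsingleton X

theorem len_eq_one_iff [IsNoetherian Λ X] [IsArtinian Λ X] :
    len Λ X = 1 ↔ IsSimpleModule Λ X := by
  rw [← Module.length_eq_one_iff, ← coe_len]
  norm_cast

theorem surjective_of_injective_of_len_le [IsNoetherian Λ X] [IsArtinian Λ X] [IsNoetherian Λ Y]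
    [IsArtinian Λ Y] {f : X →ₗ[Λ] Y} (hf : Function.Injective f) (h : len Λ Y ≤ len Λ X) :
    Function.Surjective f := by
  rw [← LinearMap.range_eq_top]
  by_contra hne
  have h1 := len_submodule_lt Λ Y (LinearMap.range f) hne
  rw [← len_eq_of_equiv (LinearEquiv.ofInjective f hf)] at h1
  omega

theorem injective_of_surjective_of_len_le [IsNoetherian Λ X] [IsArtinian Λ X] [IsNoetherian Λ Y]
    [IsArtinian Λ Y] {f : X →ₗ[Λ] Y} (hf : Function.Surjective f) (h : len Λ X ≤ len Λ Y) :
    Function.Injective f := by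
  have h1 : len Λ X = len Λ (LinearMap.ker f) + len Λ Y :=
    len_eq_add_of_exact (f := (LinearMap.ker f).subtype) (Submodule.injective_subtype _) hf
      (LinearMap.exact_subtype_ker_map f)
  have h2 : len Λ (LinearMap.ker f) = 0 := by omega
  rw [len_eq_zero_iff, Submodule.subsingleton_iff_eq_bot] at h2
  exact LinearMap.ker_eq_bot.mp h2

theorem len_mono [IsNoetherian Λ X] [IsArtinian Λ X] {A B : Submodule Λ X} (h : A ≤ B) :
    len Λ A ≤ len Λ B :=
  len_le_of_injective (Submodule.inclusion_injective h)

theorem eq_of_le_of_len_le [IsNoetherian Λ X] [IsArtinian Λ X] {A B : Submodule Λ X} (h : A ≤ B)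
    (hl : len Λ B ≤ len Λ A) : A = B := by
  refine le_antisymm h fun x hx => ?_
  obtain ⟨y, hy⟩ :=
    surjective_of_injective_of_len_le (Submodule.inclusion_injective h) hl ⟨x, hx⟩
  have : (y : X) = x := congrArg Subtype.val hy
  exact this ▸ y.2

theorem len_top : len Λ (⊤ : Submodule Λ X) = len Λ X :=
  len_eq_of_equiv Submodule.topEquiv

theorem isCompl_range_ker_of_comp_eq_id {s : X →ₗ[Λ] Y} {g : Y →ₗ[Λ] X}
    (h : g ∘ₗ s = LinearMap.id) : IsCompl (LinearMap.range s) (LinearMap.ker g) := by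
  have h' : ∀ x, g (s x) = x := fun x => LinearMap.congr_fun h x
  refine ⟨disjoint_iff.mpr ?_, codisjoint_iff.mpr ?_⟩
  · rw [eq_bot_iff]
    rintro _ ⟨⟨x, rfl⟩, hx⟩
    have : g (s x) = 0 := hx
    rw [h'] at this
    simp [this]
  · rw [eq_top_iff]
    intro y _
    rw [Submodule.mem_sup]
    exact ⟨s (g y), ⟨g y, rfl⟩, y - s (g y), by simp [h'], by abel⟩

theorem IsIndec.of_equiv (e : X ≃ₗ[Λ] Y) (h : IsIndec Λ X) : IsIndec Λ Y := by
  obtain ⟨hn, hX⟩ := h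
  refine ⟨e.injective.nontrivial, fun A B hAB => ?_⟩
  have h1 : IsCompl (A.comap e.toLinearMap) (B.comap e.toLinearMap) :=
    (Submodule.orderIsoMapComap e).symm.isCompl hAB
  have key : ∀ C : Submodule Λ Y, C.comap e.toLinearMap = ⊥ → C = ⊥ := by
    intro C hC
    rw [eq_bot_iff]
    intro y hy
    have : e.symm y ∈ C.comap e.toLinearMap := by simpa using hy
    rw [hC, Submodule.mem_bot] at this
    simpa using this
  exact (hX _ _ h1).imp (key A) (key B)

theorem isIndec_congr (e : X ≃ₗ[Λ] Y) : IsIndec Λ X ↔ IsIndec Λ Y :=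
  ⟨IsIndec.of_equiv e, IsIndec.of_equiv e.symm⟩

/-- An epimorphism from an indecomposable module onto a nonzero module which splits is an
isomorphism. -/
theorem IsIndec.bijective_of_comp_eq_id (hX : IsIndec Λ X) [Nontrivial Y] {g : X →ₗ[Λ] Y}
    {s : Y →ₗ[Λ] X} (h : g ∘ₗ s = LinearMap.id) : Function.Bijective g := by
  have h' : ∀ x, g (s x) = x := fun x => LinearMap.congr_fun h x
  refine ⟨?_, fun y => ⟨s y, h' y⟩⟩
  rcases hX.2 _ _ (isCompl_range_ker_of_comp_eq_id h) with h0 | h0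
  · obtain ⟨y, hy⟩ := exists_ne (0 : Y)
    exfalso
    apply hy
    have : s y ∈ LinearMap.range s := ⟨y, rfl⟩
    rw [h0, Submodule.mem_bot] at this
    rw [← h' y, this, map_zero]
  · exact LinearMap.ker_eq_bot.mp h0

/-- A split monomorphism from a nonzero module to an indecomposable one is an isomorphism. -/
theorem IsIndec.bijective_of_comp_eq_id' (hY : IsIndec Λ Y) [Nontrivial X] {f : X →ₗ[Λ] Y}
    {r : Y →ₗ[Λ] X} (h : r ∘ₗ f = LinearMap.id) : Function.Bijective f := by
  have hr := hY.bijective_of_comp_eq_id h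
  have h' : ∀ x, r (f x) = x := fun x => LinearMap.congr_fun h x
  refine ⟨fun a b hab => by rw [← h' a, hab, h'], fun y => ⟨r y, hr.1 (h' _)⟩⟩

/-- Fitting's lemma: an endomorphism of an indecomposable module of finite length is invertible
or nilpotent. -/
theorem IsIndec.isUnit_or_isNilpotent [IsNoetherian Λ X] [IsArtinian Λ X] (hX : IsIndec Λ X)
    (f : Module.End Λ X) : IsUnit f ∨ IsNilpotent f := by
  obtain ⟨n, hn⟩ := Filter.eventually_atTop.mp f.eventually_isCompl_ker_pow_range_pow
  have h := hn (n + 1) (Nat.le_succ n)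
  rcases hX.2 _ _ h with h0 | h0
  · left
    have hinj : Function.Injective f := by
      have : Function.Injective (f ^ (n + 1)) := LinearMap.ker_eq_bot.mp h0
      rw [pow_succ] at this
      exact Function.Injective.of_comp (f := f ^ n) this
    exact (Module.End.isUnit_iff f).mpr
      ⟨hinj, surjective_of_injective_of_len_le hinj le_rfl⟩
  · right
    exact ⟨n + 1, LinearMap.range_eq_bot.mp h0⟩

/-- The endomorphism ring of an indecomposable module of finite length is local. -/
theorem IsIndec.isUnit_or_isUnit_of_isUnit_add [IsNoetherian Λ X] [IsArtinian Λ X]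
    (hX : IsIndec Λ X) {f g : Module.End Λ X} (h : IsUnit (f + g)) : IsUnit f ∨ IsUnit g := by
  obtain ⟨u, hu⟩ := h
  have h1 : (↑u⁻¹ : Module.End Λ X) * f + ↑u⁻¹ * g = 1 := by
    rw [← mul_add, ← hu, Units.inv_mul]
  rcases hX.isUnit_or_isNilpotent (↑u⁻¹ * f) with h2 | h2
  · left
    simpa using u.isUnit.mul h2
  · right
    have h3 : IsUnit (↑u⁻¹ * g : Module.End Λ X) := by
      rw [← eq_sub_iff_add_eq'] at h1
      rw [h1]
      exact h2.isUnit_one_sub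
    simpa using u.isUnit.mul h3

theorem IsIndec.isUnit_one_sub [IsNoetherian Λ X] [IsArtinian Λ X]
    (hX : IsIndec Λ X) {f : Module.End Λ X} (h : ¬ IsUnit f) : IsUnit (1 - f) :=
  ((hX.isUnit_or_isNilpotent f).resolve_left h).isUnit_one_sub

/-- Every nonzero element of a module of finite length has a nonzero component in some
indecomposable direct summand `W`. -/
theorem exists_indec_summand_apply_ne_zero (Y : Type u) [AddCommGroup Y] [Module Λ Y]
    [IsNoetherian Λ Y] [IsArtinian Λ Y] {y : Y} (hy : y ≠ 0) :
    ∃ (W : Submodule Λ Y) (h : Y →ₗ[Λ] W), IsIndec Λ W ∧ h ∘ₗ W.subtype = LinearMap.id ∧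
      h y ≠ 0 := by
  by_cases hY : IsIndec Λ Y
  · refine ⟨⊤, Submodule.topEquiv.symm.toLinearMap, hY.of_equiv Submodule.topEquiv.symm,
      by ext; simp, by simpa using hy⟩
  · have hnt : Nontrivial Y := ⟨y, 0, hy⟩
    simp only [IsIndec, hnt, true_and, not_forall, not_or] at hY
    obtain ⟨A, B, hAB, hA, hB⟩ := hY
    have main : ∀ A B : Submodule Λ Y, IsCompl A B →
        (∀ a : A, a ≠ 0 → ∃ (W : Submodule Λ A) (h : A →ₗ[Λ] W), IsIndec Λ W ∧
          h ∘ₗ W.subtype = LinearMap.id ∧ h a ≠ 0) → y ∉ B →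
        ∃ (W : Submodule Λ Y) (h : Y →ₗ[Λ] W), IsIndec Λ W ∧ h ∘ₗ W.subtype = LinearMap.id ∧
          h y ≠ 0 := by
      intro A B hAB ih hyB
      have hne : A.projectionOnto B hAB y ≠ 0 := by
        rwa [Ne, Submodule.projectionOnto_apply_eq_zero_iff]
      obtain ⟨W, h, hW, hid, hh⟩ := ih _ hne
      let e : W ≃ₗ[Λ] W.map A.subtype := Submodule.equivMapOfInjective _ A.injective_subtype W
      refine ⟨W.map A.subtype, e.toLinearMap ∘ₗ h ∘ₗ A.projectionOnto B hAB,
        hW.of_equiv e, ?_, by simpa using hh⟩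
      refine LinearMap.ext fun x => ?_
      obtain ⟨w, rfl⟩ := e.surjective x
      have h1 : ((e w : W.map A.subtype) : Y) = ((w : A) : Y) := rfl
      have h2 : h (w : A) = w := LinearMap.congr_fun hid w
      have h3 : A.projectionOnto B hAB ((w : A) : Y) = w :=
        Submodule.projectionOnto_apply_left hAB _
      simp [h1, h2, h3]
    by_cases hyB : y ∈ B
    · have hyA : y ∉ A := fun hyA => hy (by
        have := hAB.disjoint.le_bot ⟨hyA, hyB⟩
        simpa using this)
      have hlt : len Λ B < len Λ Y := by
        refine len_submodule_lt Λ Y B fun h => hA ?_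
        have := hAB.symm
        rw [h] at this
        exact eq_bot_of_top_isCompl this
      exact main B A hAB.symm
        (fun a ha => exists_indec_summand_apply_ne_zero B ha) hyA
    · have hlt : len Λ A < len Λ Y := by
        refine len_submodule_lt Λ Y A fun h => hB ?_
        rw [h] at hAB
        exact eq_bot_of_top_isCompl hAB
      exact main A B hAB
        (fun a ha => exists_indec_summand_apply_ne_zero A ha) hyB
termination_by len Λ Y

end Basics

/-! ### The Gabriel-Roiter measure -/

section Measure

variable {Λ : Type u} [Ring Λ]

theorem exists_eq_div_two_pow_of_le {x : ℝ} {l L : ℕ} (hl : l ≤ L)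
    (h : ∃ n : ℕ, n < 2 ^ l ∧ x = n / 2 ^ l) : ∃ n : ℕ, n < 2 ^ L ∧ x = n / 2 ^ L := by
  obtain ⟨n, hn, rfl⟩ := h
  obtain ⟨d, rfl⟩ := Nat.exists_eq_add_of_le hl
  refine ⟨n * 2 ^ d, ?_, ?_⟩
  · rw [pow_add]
    exact Nat.mul_lt_mul_of_pos_right hn (by positivity)
  · push_cast
    rw [pow_add, mul_div_mul_right _ _ (by positivity)]

theorem finite_range_of_eq_div_two_pow {ι : Type*} {s : ι → ℝ} {L : ℕ}
    (h : ∀ i, ∃ n : ℕ, n < 2 ^ L ∧ s i = n / 2 ^ L) : (Set.range s).Finite := by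
  refine ((Set.finite_lt_nat (2 ^ L)).image fun n : ℕ => (n / 2 ^ L : ℝ)).subset ?_
  rintro _ ⟨i, rfl⟩
  obtain ⟨n, hn, hs⟩ := h i
  exact ⟨n, hn, hs.symm⟩

/-- The measure of `X` is a dyadic number in `[0, 1)` with at most `|X|` binary digits. -/
theorem grMeasure_eq_div (X : Type u) [AddCommGroup X] [Module Λ X]
    [IsNoetherian Λ X] [IsArtinian Λ X] :
    ∃ n : ℕ, n < 2 ^ len Λ X ∧ grMeasure Λ X = n / 2 ^ len Λ X := by
  rw [grMeasure]
  rcases subsingleton_or_nontrivial X with hX | hX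
  · have hi : ¬ IsIndec Λ X := fun h => by
      have := h.1
      exact not_subsingleton X hX
    have : IsEmpty {N : Submodule Λ X // N ≠ ⊤} := ⟨fun N => N.2 (Subsingleton.elim _ _)⟩
    refine ⟨0, by positivity, ?_⟩
    simp [hi]
  · obtain ⟨L, hL⟩ : ∃ L, len Λ X = L + 1 :=
      Nat.exists_eq_succ_of_ne_zero (len_pos (Λ := Λ) (X := X)).ne'
    have hN : ∀ N : {N : Submodule Λ X // N ≠ ⊤},
        ∃ n : ℕ, n < 2 ^ L ∧ grMeasure Λ N.1 = n / 2 ^ L := by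
      intro N
      have hlt := len_submodule_lt Λ X N.1 N.2
      exact exists_eq_div_two_pow_of_le (by omega) (grMeasure_eq_div N.1)
    have hfin := finite_range_of_eq_div_two_pow hN
    have hne : Nonempty {N : Submodule Λ X // N ≠ ⊤} := ⟨⟨⊥, bot_ne_top⟩⟩
    obtain ⟨N, hN'⟩ := (Set.range_nonempty _).csSup_mem hfin
    obtain ⟨n, hn, hnN⟩ := hN N
    have hs : ⨆ N : {N : Submodule Λ X // N ≠ ⊤}, grMeasure Λ N.1 = n / 2 ^ L := by
      rw [← hnN]
      exact hN'.symm
    rw [hs, hL]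
    split_ifs
    · refine ⟨2 * n + 1, by rw [pow_succ]; omega, ?_⟩
      push_cast
      rw [pow_succ, one_div, inv_pow, pow_succ]
      field_simp
      ring
    · refine ⟨2 * n, by rw [pow_succ]; omega, ?_⟩
      push_cast
      rw [pow_succ]
      field_simp
      ring
termination_by len Λ X

variable {X Y : Type u} [AddCommGroup X] [Module Λ X] [IsNoetherian Λ X] [IsArtinian Λ X]
  [AddCommGroup Y] [Module Λ Y] [IsNoetherian Λ Y] [IsArtinian Λ Y]

open Classical in
theorem grMeasure_eq (X : Type u) [AddCommGroup X] [Module Λ X] [IsNoetherian Λ X]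
    [IsArtinian Λ X] : grMeasure Λ X = (if IsIndec Λ X then (1 / 2 : ℝ) ^ len Λ X else 0) +
      ⨆ N : {N : Submodule Λ X // N ≠ ⊤}, grMeasure Λ N.1 := by
  rw [grMeasure]

theorem finite_range_grMeasure :
    (Set.range fun N : {N : Submodule Λ X // N ≠ ⊤} => grMeasure Λ N.1).Finite :=
  finite_range_of_eq_div_two_pow (L := len Λ X) fun N =>
    exists_eq_div_two_pow_of_le (len_submodule_lt Λ X N.1 N.2).le (grMeasure_eq_div N.1)

theorem grMeasure_congr (X Y : Type u) [AddCommGroup X] [Module Λ X]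
    [IsNoetherian Λ X] [IsArtinian Λ X] [AddCommGroup Y] [Module Λ Y]
    [IsNoetherian Λ Y] [IsArtinian Λ Y] (e : X ≃ₗ[Λ] Y) : grMeasure Λ X = grMeasure Λ Y := by
  rw [grMeasure_eq X, grMeasure_eq Y]
  congr 1
  · rw [len_eq_of_equiv e]
    by_cases h : IsIndec Λ X
    · rw [if_pos h, if_pos (h.of_equiv e)]
    · rw [if_neg h, if_neg ((isIndec_congr e).not.mp h)]
  · let E : {N : Submodule Λ X // N ≠ ⊤} ≃ {N : Submodule Λ Y // N ≠ ⊤} :=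
      (Submodule.orderIsoMapComap e).toEquiv.subtypeEquiv fun N => by
        exact (map_eq_top_iff (f := Submodule.orderIsoMapComap e) (a := N)).not.symm
    refine E.iSup_congr fun N => ?_
    have hlt := len_submodule_lt Λ X N.1 N.2
    exact (grMeasure_congr N.1 (N.1.map e.toLinearMap) (e.submoduleMap N.1)).symm
termination_by len Λ X

theorem grMeasure_add_le_of_ne_top {N : Submodule Λ X} (hN : N ≠ ⊤) (hX : IsIndec Λ X) :
    grMeasure Λ N + (1 / 2) ^ len Λ X ≤ grMeasure Λ X := by
  rw [grMeasure_eq X, if_pos hX, add_comm]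
  gcongr
  exact le_ciSup (f := fun N : {N : Submodule Λ X // N ≠ ⊤} => grMeasure Λ N.1)
    finite_range_grMeasure.bddAbove ⟨N, hN⟩

theorem grMeasure_submodule_le (N : Submodule Λ X) : grMeasure Λ N ≤ grMeasure Λ X := by
  by_cases hN : N = ⊤
  · subst hN
    exact (grMeasure_congr _ _ Submodule.topEquiv).le
  · rw [grMeasure_eq X]
    have h1 : grMeasure Λ N ≤ ⨆ N : {N : Submodule Λ X // N ≠ ⊤}, grMeasure Λ N.1 :=
      le_ciSup (f := fun N : {N : Submodule Λ X // N ≠ ⊤} => grMeasure Λ N.1)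
        finite_range_grMeasure.bddAbove ⟨N, hN⟩
    refine h1.trans (le_add_of_nonneg_left ?_)
    split_ifs <;> positivity

theorem grMeasure_le_of_injective {f : X →ₗ[Λ] Y} (hf : Function.Injective f) :
    grMeasure Λ X ≤ grMeasure Λ Y :=
  (grMeasure_congr _ _ (LinearEquiv.ofInjective f hf)).le.trans (grMeasure_submodule_le _)

/-- An embedding into an indecomposable module of at most the same measure is onto. -/
theorem surjective_of_grMeasure_le (hY : IsIndec Λ Y) {f : X →ₗ[Λ] Y}
    (hf : Function.Injective f) (h : grMeasure Λ Y ≤ grMeasure Λ X) : Function.Surjective f := by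
  rw [← LinearMap.range_eq_top]
  by_contra hne
  have h1 := grMeasure_add_le_of_ne_top hne hY
  rw [← grMeasure_congr _ _ (LinearEquiv.ofInjective f hf)] at h1
  have : (0 : ℝ) < (1 / 2) ^ len Λ Y := by positivity
  linarith

theorem exists_grMeasure_eq_iSup [Nontrivial X] :
    ∃ N : Submodule Λ X, N ≠ ⊤ ∧
      grMeasure Λ N = ⨆ N : {N : Submodule Λ X // N ≠ ⊤}, grMeasure Λ N.1 := by
  have hne : Nonempty {N : Submodule Λ X // N ≠ ⊤} := ⟨⟨⊥, bot_ne_top⟩⟩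
  obtain ⟨N, hN⟩ := (Set.range_nonempty
    fun N : {N : Submodule Λ X // N ≠ ⊤} => grMeasure Λ N.1).csSup_mem finite_range_grMeasure
  exact ⟨N.1, N.2, hN⟩

theorem IsIndec.exists_ne_top_grMeasure_add (hX : IsIndec Λ X) :
    ∃ N : Submodule Λ X, N ≠ ⊤ ∧ grMeasure Λ N + (1 / 2) ^ len Λ X = grMeasure Λ X := by
  have := hX.1
  obtain ⟨N, hN, h⟩ := exists_grMeasure_eq_iSup (Λ := Λ) (X := X)
  refine ⟨N, hN, ?_⟩
  rw [grMeasure_eq X, if_pos hX, h, add_comm]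

theorem grMeasure_of_isSimpleModule [IsSimpleModule Λ X] : grMeasure Λ X = 1 / 2 := by
  have hnt : Nontrivial X := IsSimpleModule.nontrivial Λ X
  have hX : IsIndec Λ X := ⟨hnt, fun A B hAB => by
    rcases eq_bot_or_eq_top A with h | h
    · exact Or.inl h
    · rw [h] at hAB
      exact Or.inr (eq_bot_of_top_isCompl hAB)⟩
  obtain ⟨N, hN, h⟩ := hX.exists_ne_top_grMeasure_add
  have hN' : N = ⊥ := (eq_bot_or_eq_top N).resolve_right hN
  subst hN'
  obtain ⟨n, hn, hb⟩ := grMeasure_eq_div (Λ := Λ) (⊥ : Submodule Λ X)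
  have h0 : len Λ (⊥ : Submodule Λ X) = 0 := len_eq_zero_iff.mpr inferInstance
  rw [h0] at hn hb
  have hn0 : n = 0 := by simpa using hn
  rw [hb, hn0, len_eq_one_iff.mpr ‹_›] at h
  rw [← h]
  norm_num

theorem grMeasure_pos [Nontrivial X] : 0 < grMeasure Λ X := by
  obtain ⟨S, hS, -⟩ := (eq_bot_or_exists_atom_le (⊤ : Submodule Λ X)).resolve_left top_ne_bot
  have : IsSimpleModule Λ S := isSimpleModule_iff_isAtom.mpr hS
  have h1 := grMeasure_submodule_le (Λ := Λ) S
  rw [grMeasure_of_isSimpleModule] at h1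
  linarith

/-- The measure of a nonzero module is that of one of its indecomposable submodules. -/
theorem exists_indec_submodule_grMeasure_eq (X : Type u) [AddCommGroup X] [Module Λ X]
    [IsNoetherian Λ X] [IsArtinian Λ X] [Nontrivial X] :
    ∃ N : Submodule Λ X, IsIndec Λ N ∧ grMeasure Λ N = grMeasure Λ X := by
  by_cases hX : IsIndec Λ X
  · exact ⟨⊤, hX.of_equiv Submodule.topEquiv.symm, grMeasure_congr _ _ Submodule.topEquiv⟩
  · obtain ⟨N, hN, h⟩ := exists_grMeasure_eq_iSup (Λ := Λ) (X := X)
    have h1 : grMeasure Λ N = grMeasure Λ X := by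
      rw [grMeasure_eq X, if_neg hX, h, zero_add]
    have hnt : Nontrivial N := by
      by_contra hs
      rw [not_nontrivial_iff_subsingleton] at hs
      obtain ⟨n, hn, hb⟩ := grMeasure_eq_div (Λ := Λ) N
      rw [len_eq_zero_iff.mpr hs] at hn hb
      have hn0 : n = 0 := by simpa using hn
      have := grMeasure_pos (Λ := Λ) (X := X)
      rw [← h1, hb, hn0] at this
      simp at this
    have hlt := len_submodule_lt Λ X N hN
    obtain ⟨A, hA, hAN⟩ := exists_indec_submodule_grMeasure_eq N
    let e : A ≃ₗ[Λ] A.map N.subtype := Submodule.equivMapOfInjective _ N.injective_subtype A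
    exact ⟨A.map N.subtype, hA.of_equiv e, by rw [← grMeasure_congr _ _ e, hAN, h1]⟩
termination_by len Λ X

theorem IsIndec.exists_isGRSubmodule (hX : IsIndec Λ X) (hs : ¬ IsSimpleModule Λ X) :
    ∃ N : Submodule Λ X, IsGRSubmodule N := by
  obtain ⟨N, hN, h⟩ := hX.exists_ne_top_grMeasure_add
  have hntX := hX.1
  have hnt : Nontrivial N := by
    obtain ⟨S, hS, -⟩ := (eq_bot_or_exists_atom_le (⊤ : Submodule Λ X)).resolve_left top_ne_bot
    have hsS : IsSimpleModule Λ S := isSimpleModule_iff_isAtom.mpr hS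
    have hST : S ≠ ⊤ := by
      rintro rfl
      exact hs (IsSimpleModule.congr Submodule.topEquiv.symm)
    have h1 := grMeasure_add_le_of_ne_top hST hX
    rw [grMeasure_of_isSimpleModule] at h1
    by_contra hsub
    rw [not_nontrivial_iff_subsingleton] at hsub
    obtain ⟨n, hn, hb⟩ := grMeasure_eq_div (Λ := Λ) N
    rw [len_eq_zero_iff.mpr hsub] at hn hb
    have hn0 : n = 0 := by simpa using hn
    rw [hn0] at hb
    norm_num at hb
    linarith
  obtain ⟨A, hA, hAN⟩ := exists_indec_submodule_grMeasure_eq (Λ := Λ) N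
  let e : A ≃ₗ[Λ] A.map N.subtype := Submodule.equivMapOfInjective _ N.injective_subtype A
  refine ⟨A.map N.subtype, hX, hA.of_equiv e, ?_⟩
  rw [← grMeasure_congr _ _ e, hAN]
  linarith

theorem IsGRSubmodule.ne_top {N : Submodule Λ X} (h : IsGRSubmodule N) : N ≠ ⊤ := by
  rintro rfl
  have h1 := h.2.2
  rw [grMeasure_congr _ _ (Submodule.topEquiv (R := Λ) (M := X)), sub_self] at h1
  have : (0 : ℝ) < (1 / 2) ^ len Λ X := by positivity
  linarith

/-- If `x < y + 2 ^ (-L)` for dyadic numbers with at most `L` binary digits, then `x ≤ y`. -/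
theorem le_of_lt_add_two_pow {x y : ℝ} {l L : ℕ} (hx : ∃ n : ℕ, n < 2 ^ l ∧ x = n / 2 ^ l)
    (hy : ∃ n : ℕ, n < 2 ^ L ∧ y = n / 2 ^ L) (hl : l ≤ L) (h : x < y + (1 / 2) ^ L) : x ≤ y := by
  obtain ⟨n, -, rfl⟩ := exists_eq_div_two_pow_of_le hl hx
  obtain ⟨k, -, rfl⟩ := hy
  rw [one_div, inv_pow, ← one_div, ← add_div, div_lt_div_iff_of_pos_right (by positivity)] at h
  have h' : n < k + 1 := by exact_mod_cast h
  gcongr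
  exact Nat.lt_succ_iff.mp h'

/-- Gabriel's main property. Let `X` be indecomposable and consider maps from `X` to modules `Y`
with `μ(Y) < μ(X) + 2 ^ (-|X|)`. If these maps are jointly injective, one of them is injective. -/
theorem exists_injective_of_jointly_injective (X : Type u) [AddCommGroup X] [Module Λ X]
    [IsNoetherian Λ X] [IsArtinian Λ X] (hX : IsIndec Λ X)
    (S : (Y : FLMod Λ) → (X →ₗ[Λ] Y) → Prop)
    (hS : ∀ Y f, S Y f → grMeasure Λ Y < grMeasure Λ X + (1 / 2) ^ len Λ X)
    (hinj : ∀ x : X, x ≠ 0 → ∃ Y f, S Y f ∧ f x ≠ 0) :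
    ∃ Y f, S Y f ∧ Function.Injective f := by
  by_contra! hno
  -- The components of the given maps in indecomposable summands of their images.
  have hcomp : ∀ x : X, x ≠ 0 → ∃ (W : FLMod Λ) (h : X →ₗ[Λ] W), IsIndec Λ W ∧
      grMeasure Λ W < grMeasure Λ X + (1 / 2) ^ len Λ X ∧ len Λ W < len Λ X ∧ h x ≠ 0 := by
    intro x hx
    obtain ⟨Y, f, hf, hfx⟩ := hinj x hx
    have hne : (⟨f x, x, rfl⟩ : LinearMap.range f) ≠ 0 := by simpa [Subtype.ext_iff] using hfx
    obtain ⟨W, h, hW, -, hh⟩ := exists_indec_summand_apply_ne_zero (Λ := Λ) _ hne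
    refine ⟨⟨W⟩, h ∘ₗ f.rangeRestrict, hW, ?_, ?_, hh⟩
    · exact ((grMeasure_submodule_le W).trans (grMeasure_submodule_le _)).trans_lt (hS Y f hf)
    · refine (len_le_of_injective W.injective_subtype).trans_lt ?_
      by_contra! hle
      refine hno Y f hf ?_
      have := injective_of_surjective_of_len_le f.surjective_rangeRestrict hle
      intro a b hab
      exact this (Subtype.ext hab)
  by_cases hs : IsSimpleModule Λ X
  · obtain ⟨x, hx⟩ := @exists_ne X hX.1 0
    obtain ⟨W, h, hW, -, hlt, -⟩ := hcomp x hx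
    rw [len_eq_one_iff.mpr hs, Nat.lt_one_iff, len_eq_zero_iff] at hlt
    exact not_nontrivial_iff_subsingleton.mpr hlt hW.1
  · obtain ⟨X', hX'⟩ := hX.exists_isGRSubmodule hs
    have hlt := len_submodule_lt Λ X X' hX'.ne_top
    have hμ := hX'.2.2
    -- Such a summand has fewer than `|X|` binary digits, so its measure is at most `μ(X')`.
    have hle : ∀ W : FLMod Λ, len Λ W < len Λ X →
        grMeasure Λ W < grMeasure Λ X + (1 / 2) ^ len Λ X → grMeasure Λ W ≤ grMeasure Λ X' := by
      intro W hl hm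
      obtain ⟨L, hL⟩ : ∃ L, len Λ X = L + 1 := ⟨len Λ X - 1, by omega⟩
      refine le_of_lt_add_two_pow (grMeasure_eq_div W)
        (exists_eq_div_two_pow_of_le (L := L) (by omega) (grMeasure_eq_div X')) (by omega) ?_
      rw [hL, pow_succ] at hm hμ
      linarith
    obtain ⟨W, g, ⟨hW, hWμ, h, rfl⟩, hg⟩ := exists_injective_of_jointly_injective X' hX'.2.1
      (fun W g => IsIndec Λ W ∧ grMeasure Λ W ≤ grMeasure Λ X' ∧
        ∃ h : X →ₗ[Λ] W, h ∘ₗ X'.subtype = g)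
      (by
        rintro W g ⟨-, hm, -⟩
        have : (0 : ℝ) < (1 / 2) ^ len Λ X' := by positivity
        linarith)
      (by
        intro x hx
        obtain ⟨W, h, hW, hm, hl, hh⟩ := hcomp x (by simpa using hx)
        exact ⟨W, h ∘ₗ X'.subtype, ⟨hW, hle W hl hm, h, rfl⟩, hh⟩)
    have hsurj := surjective_of_grMeasure_le hW hg hWμ
    let e := LinearEquiv.ofBijective _ ⟨hg, hsurj⟩
    have hsplit : (e.symm.toLinearMap ∘ₗ h) ∘ₗ X'.subtype = LinearMap.id :=
      LinearMap.ext fun x => e.symm_apply_apply x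
    have := hX'.2.1.1
    have hb := hX.bijective_of_comp_eq_id' hsplit
    exact hX'.ne_top (by rw [← Submodule.range_subtype X', LinearMap.range_eq_top]; exact hb.2)
termination_by len Λ X

/-- An indecomposable module `X` which is cogenerated by `Y` embeds into `Y`, provided
`μ(Y) ≤ μ(X)`. -/
theorem IsIndec.exists_injective_of_cogenerated (hX : IsIndec Λ X)
    (h : grMeasure Λ Y ≤ grMeasure Λ X) (hc : ∀ x : X, x ≠ 0 → ∃ f : X →ₗ[Λ] Y, f x ≠ 0) :
    ∃ f : X →ₗ[Λ] Y, Function.Injective f := by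
  obtain ⟨_, f, rfl, hf⟩ := exists_injective_of_jointly_injective X hX
    (fun Z _ => Z = ⟨Y⟩)
    (by
      rintro _ f rfl
      have : (0 : ℝ) < (1 / 2) ^ len Λ X := by positivity
      linarith)
    (fun x hx => by
      obtain ⟨f, hf⟩ := hc x hx
      exact ⟨⟨Y⟩, f, rfl, hf⟩)
  exact ⟨f, hf⟩

end Measure

/-! ### The radical, irreducible maps and Auslander-Reiten sequences -/

section Radical

variable {Λ : Type u} [Ring Λ] {W X Y Z A : FLMod Λ}

theorem isUnit_one_sub_comp_swap {a : X →ₗ[Λ] Y} {b : Y →ₗ[Λ] X}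
    (h : IsUnit (1 - b ∘ₗ a : Module.End Λ X)) : IsUnit (1 - a ∘ₗ b : Module.End Λ Y) := by
  rw [Module.End.isUnit_iff] at h ⊢
  constructor
  · rw [← LinearMap.ker_eq_bot, LinearMap.ker_eq_bot']
    intro y hy
    have hy' : y = a (b y) := by simpa [sub_eq_zero] using hy
    have h1 : (1 - b ∘ₗ a : Module.End Λ X) (b y) = 0 := by simp [← hy']
    have h2 : b y = 0 := (map_eq_zero_iff _ h.1).mp h1
    rw [hy', h2, map_zero]
  · intro y
    obtain ⟨x, hx⟩ := h.2 (b y)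
    have hx' : x - b (a x) = b y := by simpa using hx
    refine ⟨y + a x, ?_⟩
    have : a (b y) = a x - a (b (a x)) := by rw [← hx', map_sub]
    simp only [LinearMap.sub_apply, Module.End.one_apply, LinearMap.comp_apply, map_add, this]
    abel

theorem radHom_comp_left {f : X →ₗ[Λ] Y} (hf : f ∈ radHom X Y) (b : Y →ₗ[Λ] Z) :
    b ∘ₗ f ∈ radHom X Z :=
  fun g => hf (g ∘ₗ b)

theorem radHom_comp_right {f : X →ₗ[Λ] Y} (hf : f ∈ radHom X Y) (a : W →ₗ[Λ] X) :
    f ∘ₗ a ∈ radHom W Y := fun g =>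
  isUnit_one_sub_comp_swap (a := g ∘ₗ f) (b := a) (hf (a ∘ₗ g))

theorem not_isSplitMonoMap_of_mem_radHom [Nontrivial X] {f : X →ₗ[Λ] Y} (hf : f ∈ radHom X Y) :
    ¬ IsSplitMonoMap f := by
  rintro ⟨r, hr⟩
  have h := hf r
  rw [hr, ← Module.End.one_eq_id, sub_self] at h
  exact not_isUnit_zero h

theorem not_isSplitEpiMap_of_mem_radHom [Nontrivial Y] {f : X →ₗ[Λ] Y} (hf : f ∈ radHom X Y) :
    ¬ IsSplitEpiMap f := by
  rintro ⟨s, hs⟩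
  have h := isUnit_one_sub_comp_swap (hf s)
  rw [hs, ← Module.End.one_eq_id, sub_self] at h
  exact not_isUnit_zero h

theorem mem_radHom_of_not_isSplitMonoMap (hX : IsIndec Λ X) {f : X →ₗ[Λ] Y}
    (hf : ¬ IsSplitMonoMap f) : f ∈ radHom X Y := by
  intro g
  refine hX.isUnit_one_sub ?_
  rintro ⟨u, hu⟩
  refine hf ⟨(↑u⁻¹ : Module.End Λ X) ∘ₗ g, ?_⟩
  rw [LinearMap.comp_assoc, ← hu]
  exact u.inv_mul

theorem mem_radHom_of_not_isSplitEpiMap (hY : IsIndec Λ Y) {f : X →ₗ[Λ] Y}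
    (hf : ¬ IsSplitEpiMap f) : f ∈ radHom X Y := by
  intro g
  refine isUnit_one_sub_comp_swap (hY.isUnit_one_sub ?_)
  rintro ⟨u, hu⟩
  refine hf ⟨g ∘ₗ (↑u⁻¹ : Module.End Λ Y), ?_⟩
  rw [← LinearMap.comp_assoc, ← hu]
  exact u.mul_inv

theorem mem_radHom_iff_not_isSplitEpiMap (hY : IsIndec Λ Y) {f : X →ₗ[Λ] Y} :
    f ∈ radHom X Y ↔ ¬ IsSplitEpiMap f :=
  have := hY.1
  ⟨not_isSplitEpiMap_of_mem_radHom, mem_radHom_of_not_isSplitEpiMap hY⟩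

theorem mem_radHom_iff_not_isSplitMonoMap (hX : IsIndec Λ X) {f : X →ₗ[Λ] Y} :
    f ∈ radHom X Y ↔ ¬ IsSplitMonoMap f :=
  have := hX.1
  ⟨not_isSplitMonoMap_of_mem_radHom, mem_radHom_of_not_isSplitMonoMap hX⟩

theorem zero_mem_radHom : (0 : X →ₗ[Λ] Y) ∈ radHom X Y := fun g => by simp

theorem neg_mem_radHom {f : X →ₗ[Λ] Y} (hf : f ∈ radHom X Y) : -f ∈ radHom X Y := fun g => by
  simpa using hf (-g)

theorem add_mem_radHom_of_isIndec_right (hY : IsIndec Λ Y) {f g : X →ₗ[Λ] Y}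
    (hf : f ∈ radHom X Y) (hg : g ∈ radHom X Y) : f + g ∈ radHom X Y := by
  rw [mem_radHom_iff_not_isSplitEpiMap hY] at hf hg ⊢
  rintro ⟨s, hs⟩
  have h : IsUnit ((f ∘ₗ s : Module.End Λ Y) + (g ∘ₗ s : Module.End Λ Y)) := by
    rw [← LinearMap.add_comp, hs]
    exact isUnit_one
  rcases hY.isUnit_or_isUnit_of_isUnit_add h with ⟨u, hu⟩ | ⟨u, hu⟩
  · exact hf ⟨s ∘ₗ (↑u⁻¹ : Module.End Λ Y), by rw [← LinearMap.comp_assoc, ← hu]; exact u.mul_inv⟩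
  · exact hg ⟨s ∘ₗ (↑u⁻¹ : Module.End Λ Y), by rw [← LinearMap.comp_assoc, ← hu]; exact u.mul_inv⟩

theorem add_mem_radHom_of_isIndec_left (hX : IsIndec Λ X) {f g : X →ₗ[Λ] Y}
    (hf : f ∈ radHom X Y) (hg : g ∈ radHom X Y) : f + g ∈ radHom X Y := by
  rw [mem_radHom_iff_not_isSplitMonoMap hX] at hf hg ⊢
  rintro ⟨s, hs⟩
  have h : IsUnit ((s ∘ₗ f : Module.End Λ X) + (s ∘ₗ g : Module.End Λ X)) := by
    rw [← LinearMap.comp_add, hs]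
    exact isUnit_one
  rcases hX.isUnit_or_isUnit_of_isUnit_add h with ⟨u, hu⟩ | ⟨u, hu⟩
  · exact hf ⟨(↑u⁻¹ : Module.End Λ X) ∘ₗ s, by rw [LinearMap.comp_assoc, ← hu]; exact u.inv_mul⟩
  · exact hg ⟨(↑u⁻¹ : Module.End Λ X) ∘ₗ s, by rw [LinearMap.comp_assoc, ← hu]; exact u.inv_mul⟩

theorem comp_mem_radSqHom {f : X →ₗ[Λ] Y} {g : Y →ₗ[Λ] Z} (hf : f ∈ radHom X Y)
    (hg : g ∈ radHom Y Z) : g ∘ₗ f ∈ radSqHom X Z :=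
  AddSubgroup.subset_closure ⟨Y, f, hf, g, hg, rfl⟩

theorem comp_comp_mem_radSqHom {h : X →ₗ[Λ] Y} (hh : h ∈ radSqHom X Y) (a : W →ₗ[Λ] X)
    (b : Y →ₗ[Λ] Z) : b ∘ₗ h ∘ₗ a ∈ radSqHom W Z := by
  induction hh using AddSubgroup.closure_induction with
  | mem x hx =>
    obtain ⟨V, f, hf, g, hg, rfl⟩ := hx
    exact comp_mem_radSqHom (f := f ∘ₗ a) (g := b ∘ₗ g) (radHom_comp_right hf a)
      (radHom_comp_left hg b)
  | zero => simp
  | add x y _ _ hx hy =>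
    rw [LinearMap.add_comp, LinearMap.comp_add]
    exact (radSqHom W Z).add_mem hx hy
  | neg x _ hx =>
    rw [LinearMap.neg_comp, LinearMap.comp_neg]
    exact (radSqHom W Z).neg_mem hx

end Radical

section Irreducible

variable {Λ : Type u} [Ring Λ]

theorem IsIrreducibleMap.congr {X Y X' Y' : IndMod Λ} {f : X →ₗ[Λ] Y} (hf : IsIrreducibleMap f)
    (a : X ≃ₗ[Λ] X') (b : Y ≃ₗ[Λ] Y') :
    IsIrreducibleMap (X := X') (Y := Y') (b.toLinearMap ∘ₗ f ∘ₗ a.symm.toLinearMap) := by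
  refine ⟨radHom_comp_left (radHom_comp_right hf.1 _) _, fun h => hf.2 ?_⟩
  have h1 := comp_comp_mem_radSqHom h a.toLinearMap b.symm.toLinearMap
  convert h1 using 1
  ext x
  simp

theorem arArrow_cls_iff {X Y : IndMod Λ} :
    ARArrow X.cls Y.cls ↔ ∃ f : X →ₗ[Λ] Y, IsIrreducibleMap f := by
  constructor
  · rintro ⟨X', Y', hX, hY, f, hf⟩
    obtain ⟨a⟩ : Nonempty (X' ≃ₗ[Λ] X) := Quotient.exact hX
    obtain ⟨b⟩ : Nonempty (Y' ≃ₗ[Λ] Y) := Quotient.exact hY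
    exact ⟨_, hf.congr a b⟩
  · rintro ⟨f, hf⟩
    exact ⟨X, Y, rfl, rfl, f, hf⟩

theorem IsIrreducibleMap.injective_or_surjective {X Y : IndMod Λ} {f : X →ₗ[Λ] Y}
    (hf : IsIrreducibleMap f) : Function.Injective f ∨ Function.Surjective f := by
  by_contra! hno
  let R : FLMod Λ := ⟨LinearMap.range f⟩
  have h1 : (f.rangeRestrict : X →ₗ[Λ] R) ∈ radHom X.toFLMod R := by
    refine mem_radHom_of_not_isSplitMonoMap X.indec ?_
    rintro ⟨r, hr⟩
    refine hno.1 fun x y hxy => ?_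
    have h : f.rangeRestrict x = f.rangeRestrict y := Subtype.ext hxy
    have hr' : ∀ x, r (f.rangeRestrict x) = x := fun x => LinearMap.congr_fun hr x
    rw [← hr' x, h, hr']
  have h2 : ((LinearMap.range f).subtype : R →ₗ[Λ] Y) ∈ radHom R Y.toFLMod := by
    refine mem_radHom_of_not_isSplitEpiMap Y.indec ?_
    rintro ⟨s, hs⟩
    refine hno.2 fun y => ?_
    have hs' : (LinearMap.range f).subtype (s y) = y := LinearMap.congr_fun hs y
    rw [← hs']
    exact (s y).2
  exact hf.2 (comp_mem_radSqHom h1 h2)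

theorem IsIrreducibleMap.len_ne {X Y : IndMod Λ} {f : X →ₗ[Λ] Y}
    (hf : IsIrreducibleMap f) : len Λ X ≠ len Λ Y := by
  intro h
  have hb : Function.Bijective f := by
    rcases hf.injective_or_surjective with hi | hs
    · exact ⟨hi, surjective_of_injective_of_len_le hi h.ge⟩
    · exact ⟨injective_of_surjective_of_len_le hs h.le, hs⟩
  have := X.indec.1
  refine not_isSplitMonoMap_of_mem_radHom hf.1 ⟨(LinearEquiv.ofBijective f hb).symm, ?_⟩
  exact LinearMap.ext fun x => (LinearEquiv.ofBijective f hb).symm_apply_apply x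

end Irreducible

section ARSequences

variable {Λ : Type u} [Ring Λ] {X Y Z A : FLMod Λ} {f : X →ₗ[Λ] Y} {g : Y →ₗ[Λ] Z}

theorem IsARSequence.comp_eq_zero (h : IsARSequence f g) (x : X) : g (f x) = 0 :=
  (h.exact (f x)).mpr ⟨x, rfl⟩

theorem IsARSequence.congr_middle {Y' : FLMod Λ} (h : IsARSequence f g) (e : Y ≃ₗ[Λ] Y') :
    IsARSequence (e.toLinearMap ∘ₗ f) (g ∘ₗ e.symm.toLinearMap) where
  injective := e.injective.comp h.injective
  exact y := by
    have := h.exact (e.symm y)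
    simp only [LinearMap.comp_apply, LinearEquiv.coe_coe, Set.mem_range] at this ⊢
    rw [this]
    exact exists_congr fun x => by rw [LinearEquiv.eq_symm_apply]
  surjective := h.surjective.comp e.symm.surjective
  not_splitMono := fun ⟨r, hr⟩ => h.not_splitMono ⟨r ∘ₗ e.toLinearMap, hr⟩
  left_almost_split W k hk := by
    obtain ⟨k', hk'⟩ := h.left_almost_split W k hk
    refine ⟨k' ∘ₗ e.symm.toLinearMap, ?_⟩
    rw [← hk']
    ext x
    simp
  not_splitEpi := fun ⟨s, hs⟩ => h.not_splitEpi ⟨e.symm.toLinearMap ∘ₗ s, hs⟩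
  right_almost_split W k hk := by
    obtain ⟨k', hk'⟩ := h.right_almost_split W k hk
    refine ⟨e.toLinearMap ∘ₗ k', ?_⟩
    rw [← hk']
    ext x
    simp

theorem IsARSequence.congr_left {X' : FLMod Λ} (h : IsARSequence f g) (a : X' ≃ₗ[Λ] X) :
    IsARSequence (f ∘ₗ a.toLinearMap) g where
  injective := h.injective.comp a.injective
  exact y := by
    rw [h.exact y]
    exact ⟨fun ⟨x, hx⟩ => ⟨a.symm x, by simpa using hx⟩, fun ⟨x, hx⟩ => ⟨a x, hx⟩⟩
  surjective := h.surjective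
  not_splitMono := fun ⟨r, hr⟩ => h.not_splitMono ⟨a.toLinearMap ∘ₗ r, LinearMap.ext fun x => by
    have : r (f (a (a.symm x))) = a.symm x := LinearMap.congr_fun hr _
    simp only [LinearEquiv.apply_symm_apply] at this
    simp [this]⟩
  left_almost_split W k hk := by
    obtain ⟨k', hk'⟩ := h.left_almost_split W (k ∘ₗ a.symm.toLinearMap) (fun ⟨r, hr⟩ =>
      hk ⟨a.symm.toLinearMap ∘ₗ r, LinearMap.ext fun x => by
        have : r (k (a.symm (a x))) = a x := LinearMap.congr_fun hr _
        simp only [LinearEquiv.symm_apply_apply] at this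
        simp [this]⟩)
    refine ⟨k', ?_⟩
    rw [← LinearMap.comp_assoc, hk']
    ext x
    simp
  not_splitEpi := h.not_splitEpi
  right_almost_split := h.right_almost_split

theorem IsARSequence.congr_right {Z' : FLMod Λ} (h : IsARSequence f g) (c : Z ≃ₗ[Λ] Z') :
    IsARSequence f (c.toLinearMap ∘ₗ g) where
  injective := h.injective
  exact y := by
    rw [← h.exact y]
    simp
  surjective := c.surjective.comp h.surjective
  not_splitMono := h.not_splitMono
  left_almost_split := h.left_almost_split
  not_splitEpi := fun ⟨s, hs⟩ => h.not_splitEpi ⟨s ∘ₗ c.toLinearMap, LinearMap.ext fun z => by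
    have : c (g (s (c z))) = c z := LinearMap.congr_fun hs _
    simpa using this⟩
  right_almost_split W k hk := by
    obtain ⟨k', hk'⟩ := h.right_almost_split W (c.symm.toLinearMap ∘ₗ k) (fun ⟨s, hs⟩ =>
      hk ⟨s ∘ₗ c.symm.toLinearMap, LinearMap.ext fun z => by
        have : c.symm (k (s (c.symm z))) = c.symm z := LinearMap.congr_fun hs _
        simpa using this⟩)
    refine ⟨k', ?_⟩
    rw [LinearMap.comp_assoc, hk']
    ext x
    simp

/-- The first map of an Auslander-Reiten sequence is left minimal. -/
theorem IsARSequence.bijective_of_comp_left (h : IsARSequence f g) (hZ : IsIndec Λ Z)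
    {θ : Module.End Λ Y} (hθ : ∀ x, θ (f x) = f x) : Function.Bijective θ := by
  have hker : LinearMap.ker g ≤ LinearMap.ker (g ∘ₗ θ) := by
    intro y hy
    obtain ⟨x, rfl⟩ := (h.exact y).mp hy
    simp [hθ, h.comp_eq_zero]
  let ζ : Module.End Λ Z := (LinearMap.ker g).liftQ (g ∘ₗ θ) hker ∘ₗ
    (g.quotKerEquivOfSurjective h.surjective).symm.toLinearMap
  have hζ : ∀ y, ζ (g y) = g (θ y) := by
    intro y
    have : (g.quotKerEquivOfSurjective h.surjective).symm (g y) = (LinearMap.ker g).mkQ y := by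
      rw [LinearEquiv.symm_apply_eq]
      rfl
    simp [ζ, this]
  rcases hZ.isUnit_or_isNilpotent ζ with hu | ⟨n, hn⟩
  · have hinj : Function.Injective θ := by
      rw [← LinearMap.ker_eq_bot, LinearMap.ker_eq_bot']
      intro y hy
      have h1 : ζ (g y) = 0 := by rw [hζ, hy, map_zero]
      have h2 : g y = 0 := (map_eq_zero_iff _ ((Module.End.isUnit_iff ζ).mp hu).1).mp h1
      obtain ⟨x, rfl⟩ := (h.exact y).mp h2
      rw [← hθ, hy]
    exact ⟨hinj, surjective_of_injective_of_len_le hinj le_rfl⟩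
  · exfalso
    have hpow : ∀ m : ℕ, ∀ y, g ((θ ^ m) y) = (ζ ^ m) (g y) := by
      intro m
      induction m with
      | zero => intro y; rfl
      | succ m ih => intro y; rw [pow_succ, pow_succ, Module.End.mul_apply, Module.End.mul_apply,
          ih, hζ]
    have hfix : ∀ m : ℕ, ∀ x, (θ ^ m) (f x) = f x := by
      intro m
      induction m with
      | zero => intro x; rfl
      | succ m ih => intro x; rw [pow_succ, Module.End.mul_apply, hθ, ih]
    have hrange : ∀ y, (θ ^ n) y ∈ LinearMap.range f := fun y =>
      (h.exact _).mp (by rw [hpow, hn]; rfl)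
    let e := LinearEquiv.ofInjective f h.injective
    refine h.not_splitMono ⟨e.symm.toLinearMap ∘ₗ (θ ^ n).codRestrict _ hrange, ?_⟩
    refine LinearMap.ext fun x => ?_
    simp only [LinearMap.comp_apply, LinearEquiv.coe_coe, LinearMap.id_apply]
    rw [LinearEquiv.symm_apply_eq]
    exact Subtype.ext (hfix n x)

/-- The second map of an Auslander-Reiten sequence is right minimal. -/
theorem IsARSequence.bijective_of_comp_right (h : IsARSequence f g) (hX : IsIndec Λ X)
    {θ : Module.End Λ Y} (hθ : ∀ y, g (θ y) = g y) : Function.Bijective θ := by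
  have hrange : ∀ x, θ (f x) ∈ LinearMap.range f := fun x =>
    (h.exact _).mp (by rw [hθ, h.comp_eq_zero])
  let e := LinearEquiv.ofInjective f h.injective
  let ξ : Module.End Λ X := e.symm.toLinearMap ∘ₗ (θ ∘ₗ f).codRestrict _ hrange
  have hξ : ∀ x, f (ξ x) = θ (f x) := fun x => by
    have : e (ξ x) = (θ ∘ₗ f).codRestrict _ hrange x := e.apply_symm_apply _
    exact congrArg Subtype.val this
  rcases hX.isUnit_or_isNilpotent ξ with hu | ⟨n, hn⟩
  · have hinj : Function.Injective θ := by
      rw [← LinearMap.ker_eq_bot, LinearMap.ker_eq_bot']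
      intro y hy
      have h1 : g y = 0 := by rw [← hθ, hy, map_zero]
      obtain ⟨x, rfl⟩ := (h.exact y).mp h1
      rw [← hξ, map_eq_zero_iff _ h.injective,
        map_eq_zero_iff _ ((Module.End.isUnit_iff ξ).mp hu).1] at hy
      rw [hy, map_zero]
    exact ⟨hinj, surjective_of_injective_of_len_le hinj le_rfl⟩
  · exfalso
    have hpow : ∀ m : ℕ, ∀ x, f ((ξ ^ m) x) = (θ ^ m) (f x) := by
      intro m
      induction m with
      | zero => intro x; rfl
      | succ m ih => intro x; rw [pow_succ, pow_succ, Module.End.mul_apply, Module.End.mul_apply,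
          ih, hξ]
    have hfix : ∀ m : ℕ, ∀ y, g ((θ ^ m) y) = g y := by
      intro m
      induction m with
      | zero => intro x; rfl
      | succ m ih => intro x; rw [pow_succ, Module.End.mul_apply, ih, hθ]
    have hker : LinearMap.ker g ≤ LinearMap.ker (θ ^ n) := by
      intro y hy
      obtain ⟨x, rfl⟩ := (h.exact y).mp hy
      rw [LinearMap.mem_ker, ← hpow, hn]
      simp
    refine h.not_splitEpi ⟨(LinearMap.ker g).liftQ (θ ^ n) hker ∘ₗ
      (g.quotKerEquivOfSurjective h.surjective).symm.toLinearMap, ?_⟩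
    refine LinearMap.ext fun z => ?_
    obtain ⟨y, rfl⟩ := h.surjective z
    have : (g.quotKerEquivOfSurjective h.surjective).symm (g y) = (LinearMap.ker g).mkQ y := by
      rw [LinearEquiv.symm_apply_eq]
      rfl
    simp [this, hfix]

/-- In an Auslander-Reiten sequence `0 → X → Y → Z → 0`, the composite of `X → Y` with the
projection onto an indecomposable direct summand of `Y` is irreducible. -/
theorem IsARSequence.comp_mem_radHom_notMem_radSqHom (h : IsARSequence f g) (hX : IsIndec Λ X)
    (hZ : IsIndec Λ Z) (hA : IsIndec Λ A) {p : Y →ₗ[Λ] A} {s : A →ₗ[Λ] Y}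
    (hps : p ∘ₗ s = LinearMap.id) : p ∘ₗ f ∈ radHom X A ∧ p ∘ₗ f ∉ radSqHom X A := by
  have hnt := hX.1
  refine ⟨mem_radHom_of_not_isSplitMonoMap hX fun ⟨r, hr⟩ => h.not_splitMono ⟨r ∘ₗ p, hr⟩, ?_⟩
  intro hsq
  have key : ∀ k ∈ radSqHom X A, ∃ r ∈ radHom Y A, k = r ∘ₗ f := by
    intro k hk
    induction hk using AddSubgroup.closure_induction with
    | mem x hx =>
      obtain ⟨V, a, ha, b, hb, rfl⟩ := hx
      obtain ⟨a', rfl⟩ := h.left_almost_split V a (not_isSplitMonoMap_of_mem_radHom ha)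
      exact ⟨b ∘ₗ a', radHom_comp_right hb a', rfl⟩
    | zero => exact ⟨0, zero_mem_radHom, by simp⟩
    | add x y _ _ hx hy =>
      obtain ⟨r, hr, rfl⟩ := hx
      obtain ⟨r', hr', rfl⟩ := hy
      exact ⟨r + r', add_mem_radHom_of_isIndec_right hA hr hr', by rw [LinearMap.add_comp]⟩
    | neg x _ hx =>
      obtain ⟨r, hr, rfl⟩ := hx
      exact ⟨-r, neg_mem_radHom hr, by rw [LinearMap.neg_comp]⟩
  obtain ⟨r, hr, hpr⟩ := key _ hsq
  have hpr' : ∀ x, p (f x) = r (f x) := fun x => LinearMap.congr_fun hpr x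
  have hps' : ∀ a, p (s a) = a := fun a => LinearMap.congr_fun hps a
  -- `θ` fixes the image of `f` and satisfies `p ∘ θ = r`, so `r` would be a split epimorphism.
  have hb : Function.Bijective (LinearMap.id - s ∘ₗ (p - r) : Module.End Λ Y) :=
    h.bijective_of_comp_left hZ fun x => by simp [hpr']
  let θ := LinearEquiv.ofBijective _ hb
  have hθ : ∀ y, p (θ y) = r y := fun y => by
    change p ((LinearMap.id - s ∘ₗ (p - r) : Module.End Λ Y) y) = r y
    simp [hps']
  rw [mem_radHom_iff_not_isSplitEpiMap hA] at hr
  exact hr ⟨θ.symm.toLinearMap ∘ₗ s, LinearMap.ext fun a => by simp [← hθ, hps']⟩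

/-- In an Auslander-Reiten sequence `0 → X → Y → Z → 0`, the restriction of `Y → Z` to an
indecomposable direct summand of `Y` is irreducible. -/
theorem IsARSequence.comp_mem_radHom_notMem_radSqHom' (h : IsARSequence f g) (hX : IsIndec Λ X)
    (hZ : IsIndec Λ Z) (hA : IsIndec Λ A) {p : Y →ₗ[Λ] A} {s : A →ₗ[Λ] Y}
    (hps : p ∘ₗ s = LinearMap.id) : g ∘ₗ s ∈ radHom A Z ∧ g ∘ₗ s ∉ radSqHom A Z := by
  have hnt := hZ.1
  refine ⟨mem_radHom_of_not_isSplitEpiMap hZ fun ⟨r, hr⟩ => h.not_splitEpi ⟨s ∘ₗ r, hr⟩, ?_⟩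
  intro hsq
  have key : ∀ k ∈ radSqHom A Z, ∃ r ∈ radHom A Y, k = g ∘ₗ r := by
    intro k hk
    induction hk using AddSubgroup.closure_induction with
    | mem x hx =>
      obtain ⟨V, a, ha, b, hb, rfl⟩ := hx
      obtain ⟨b', rfl⟩ := h.right_almost_split V b (not_isSplitEpiMap_of_mem_radHom hb)
      exact ⟨b' ∘ₗ a, radHom_comp_left ha b', rfl⟩
    | zero => exact ⟨0, zero_mem_radHom, by simp⟩
    | add x y _ _ hx hy =>
      obtain ⟨r, hr, rfl⟩ := hx
      obtain ⟨r', hr', rfl⟩ := hy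
      exact ⟨r + r', add_mem_radHom_of_isIndec_left hA hr hr', by rw [LinearMap.comp_add]⟩
    | neg x _ hx =>
      obtain ⟨r, hr, rfl⟩ := hx
      exact ⟨-r, neg_mem_radHom hr, by rw [LinearMap.comp_neg]⟩
  obtain ⟨r, hr, hgr⟩ := key _ hsq
  have hgr' : ∀ a, g (s a) = g (r a) := fun a => LinearMap.congr_fun hgr a
  have hps' : ∀ a, p (s a) = a := fun a => LinearMap.congr_fun hps a
  have hb : Function.Bijective (LinearMap.id - (s - r) ∘ₗ p : Module.End Λ Y) :=
    h.bijective_of_comp_right hX fun y => by simp [hgr']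
  let θ := LinearEquiv.ofBijective _ hb
  have hθ : ∀ a, θ (s a) = r a := fun a => by
    change (LinearMap.id - (s - r) ∘ₗ p : Module.End Λ Y) (s a) = r a
    simp [hps']
  rw [mem_radHom_iff_not_isSplitMonoMap hA] at hr
  exact hr ⟨p ∘ₗ θ.symm.toLinearMap, LinearMap.ext fun a => by simp [← hθ, hps']⟩

/-- An irreducible map `X → A` factors through `X → Y` by a split epimorphism: the module `A` is a
direct summand of the middle term of the Auslander-Reiten sequence starting in `X`. -/
theorem IsARSequence.exists_isSplitEpiMap {X A : IndMod Λ} {Y Z : FLMod Λ}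
    {f : X.toFLMod →ₗ[Λ] Y} {g : Y →ₗ[Λ] Z} (h : IsARSequence f g) {k : X →ₗ[Λ] A}
    (hk : IsIrreducibleMap k) :
    ∃ p : Y →ₗ[Λ] A.toFLMod, IsSplitEpiMap p ∧ p ∘ₗ f = k := by
  have := X.indec.1
  obtain ⟨p, hp⟩ := h.left_almost_split A.toFLMod k (not_isSplitMonoMap_of_mem_radHom hk.1)
  refine ⟨p, ?_, hp⟩
  by_contra hno
  refine hk.2 ?_
  rw [← hp]
  exact comp_mem_radSqHom (mem_radHom_of_not_isSplitMonoMap X.indec h.not_splitMono)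
    (mem_radHom_of_not_isSplitEpiMap A.indec hno)

theorem IsARSequence.exists_isSplitMonoMap {Z A : IndMod Λ} {X Y : FLMod Λ}
    {f : X →ₗ[Λ] Y} {g : Y →ₗ[Λ] Z.toFLMod} (h : IsARSequence f g) {k : A →ₗ[Λ] Z}
    (hk : IsIrreducibleMap k) :
    ∃ s : A.toFLMod →ₗ[Λ] Y, IsSplitMonoMap s ∧ g ∘ₗ s = k := by
  have := Z.indec.1
  obtain ⟨s, hs⟩ := h.right_almost_split A.toFLMod k (not_isSplitEpiMap_of_mem_radHom hk.1)
  refine ⟨s, ?_, hs⟩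
  by_contra hno
  refine hk.2 ?_
  rw [← hs]
  exact comp_mem_radSqHom (mem_radHom_of_not_isSplitMonoMap A.indec hno)
    (mem_radHom_of_not_isSplitEpiMap Z.indec h.not_splitEpi)

end ARSequences

/-! ### The Auslander-Reiten sequences of a homogeneous tube -/

section Tube

variable {Λ : Type u} [Ring Λ]

/-- The direct sum of two modules of finite length. -/
abbrev FLMod.prod (X Y : FLMod Λ) : FLMod Λ := ⟨X × Y⟩

/-- The modules of a homogeneous tube, numbered from `0`: the module `N t` lies at the vertex
`t + 1` of `ℤA_∞/τ`. The fields record what is used of the isomorphism of translation quivers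
and of the fact that the tube is a connected component. -/
structure IsTubeSeq (N : ℕ → IndMod Λ) : Prop where
  eq_of_equiv : ∀ s t, Nonempty (N s ≃ₗ[Λ] N t) → s = t
  exists_up : ∀ t, ∃ h : N t →ₗ[Λ] N (t + 1), IsIrreducibleMap h
  exists_down : ∀ t, ∃ h : N (t + 1) →ₗ[Λ] N t, IsIrreducibleMap h
  exists_ar : ∀ t, ∃ (Y : FLMod Λ) (f : (N t).toFLMod →ₗ[Λ] Y) (g : Y →ₗ[Λ] (N t).toFLMod),
    IsARSequence f g
  adjacent : ∀ t (W : IndMod Λ) (h : N t →ₗ[Λ] W), IsIrreducibleMap h →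
    ∃ s, Nonempty (W ≃ₗ[Λ] N s) ∧ (s = t + 1 ∨ t = s + 1)

theorem zAInfModTauArrow_iff {s t : ℕ+} : ZAInfModTauArrow s t ↔ t = s + 1 ∨ s = t + 1 := by
  constructor
  · rintro ⟨i, j, ⟨-, h⟩ | ⟨-, h⟩⟩
    · exact Or.inl h
    · exact Or.inr h
  · rintro (h | h)
    · exact ⟨0, 0, Or.inl ⟨rfl, h⟩⟩
    · exact ⟨0, 1, Or.inr ⟨rfl, h⟩⟩

theorem zAInfModTauTau_self (t : ℕ+) : ZAInfModTauTau t t := ⟨0, 1, rfl⟩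

theorem isTubeSeq_of_isTubeLabelling {T : Set (ARVertex Λ)} (hT : IsARComponent T)
    {M : ℕ+ → IndMod Λ} (hM : IsTubeLabelling T M) : IsTubeSeq fun t => M t.succPNat := by
  obtain ⟨e, he, hcls⟩ := hM
  obtain ⟨x, rfl⟩ := hT
  have harrow : ∀ s t : ℕ+, (t = s + 1 ∨ s = t + 1) →
      ∃ f : M s →ₗ[Λ] M t, IsIrreducibleMap f := fun s t hst => by
    rw [← arArrow_cls_iff, hcls, hcls, he.arrow_iff, zAInfModTauArrow_iff]
    exact hst
  refine ⟨fun s t hst => ?_, fun t => harrow _ _ (Or.inl rfl), fun t => harrow _ _ (Or.inr rfl),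
    fun t => ?_, fun t W h hirr => ?_⟩
  · have h1 : (M s.succPNat).cls = (M t.succPNat).cls := Quotient.sound hst
    rw [hcls, hcls] at h1
    exact Nat.succPNat_injective (e.injective (Subtype.ext h1))
  · obtain ⟨X, Y, Z, hX, hZ, f, g, hfg⟩ :=
      (he.tau_iff t.succPNat t.succPNat).mpr (zAInfModTauTau_self _)
    rw [← hcls] at hX hZ
    obtain ⟨a⟩ : Nonempty (X ≃ₗ[Λ] M t.succPNat) := Quotient.exact hX
    obtain ⟨c⟩ : Nonempty (Z ≃ₗ[Λ] M t.succPNat) := Quotient.exact hZ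
    exact ⟨Y, _, _, (hfg.congr_left (X' := (M t.succPNat).toFLMod) a.symm).congr_right
      (Z' := (M t.succPNat).toFLMod) c⟩
  · have h1 : ARArrow (e t.succPNat).1 W.cls := by
      rw [← hcls, arArrow_cls_iff]
      exact ⟨h, hirr⟩
    have h2 : W.cls ∈ {y | Relation.EqvGen ARArrow x y} :=
      Relation.EqvGen.trans _ _ _ (e t.succPNat).2 (Relation.EqvGen.rel _ _ h1)
    obtain ⟨s, hs⟩ := e.surjective ⟨W.cls, h2⟩
    have hs' : W.cls = (e s).1 := by rw [hs]
    rw [hs', he.arrow_iff, zAInfModTauArrow_iff] at h1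
    refine ⟨s.natPred, ?_, ?_⟩
    · rw [PNat.succPNat_natPred]
      exact Quotient.exact (hs'.trans (hcls s).symm)
    · rcases h1 with h1 | h1
      · left
        rw [h1]
        rfl
      · right
        have h2 := congrArg PNat.val h1
        have h3 := PNat.natPred_add_one s
        simp only [Nat.succPNat_coe, PNat.add_coe, PNat.one_coe] at h2
        omega

theorem exists_equiv_prod_ker_of_isSplitEpiMap {Y A : FLMod Λ} {p : Y →ₗ[Λ] A}
    (hp : IsSplitEpiMap p) : Nonempty (Y ≃ₗ[Λ] A × LinearMap.ker p) := by
  obtain ⟨s, hs⟩ := hp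
  have hs' : ∀ a, p (s a) = a := fun a => LinearMap.congr_fun hs a
  refine ⟨LinearEquiv.ofLinearMap
    (p.prod ((LinearMap.id - s ∘ₗ p).codRestrict (LinearMap.ker p) fun y => by simp [hs']))
    (s.coprod (LinearMap.ker p).subtype) ?_ ?_⟩
  · refine LinearMap.ext fun ⟨a, b, hb⟩ => Prod.ext ?_ (Subtype.ext ?_)
    · simp [hs', LinearMap.mem_ker.mp hb]
    · simp [hs', LinearMap.mem_ker.mp hb]
  · refine LinearMap.ext fun y => ?_
    simp

/-- The module below `N t` in the tube: it is zero for `t = 0` and `N (t - 1)` otherwise. -/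
def tubeBelow (N : ℕ → IndMod Λ) : ℕ → FLMod Λ
  | 0 => ⟨PUnit⟩
  | t + 1 => (N t).toFLMod

variable {N : ℕ → IndMod Λ}

instance : Subsingleton (tubeBelow N 0) := inferInstanceAs (Subsingleton PUnit)

theorem IsIndec.isSplitEpiMap_coprod {A C E : FLMod Λ} (hE : IsIndec Λ E) {u : A →ₗ[Λ] E}
    {v : C →ₗ[Λ] E} (h : IsSplitEpiMap (X := A.prod C) (u.coprod v)) :
    IsSplitEpiMap u ∨ IsSplitEpiMap v := by
  by_contra! hno
  rw [← mem_radHom_iff_not_isSplitEpiMap hE, ← mem_radHom_iff_not_isSplitEpiMap hE] at hno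
  have h1 := add_mem_radHom_of_isIndec_right (X := A.prod C) hE
    (radHom_comp_right hno.1 (LinearMap.fst Λ A C))
    (radHom_comp_right hno.2 (LinearMap.snd Λ A C))
  rw [mem_radHom_iff_not_isSplitEpiMap hE] at h1
  exact h1 h

theorem not_isSplitEpiMap_of_ne (hN : IsTubeSeq N) {s t : ℕ} (hst : s ≠ t)
    (p : (N s).toFLMod →ₗ[Λ] (N t).toFLMod) : ¬ IsSplitEpiMap p := by
  rintro ⟨r, hr⟩
  have := (N t).indec.1
  exact hst (hN.eq_of_equiv s t
    ⟨LinearEquiv.ofBijective p ((N s).indec.bijective_of_comp_eq_id hr)⟩)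

/-- Both neighbours of `N t` occur in the middle term of the Auslander-Reiten sequence. -/
theorem IsTubeSeq.exists_isARSequence_prod (hN : IsTubeSeq N) (t : ℕ) :
    ∃ (D : FLMod Λ)
      (f : (N t).toFLMod →ₗ[Λ] (((N (t + 1)).toFLMod.prod (tubeBelow N t)).prod D))
      (g : (((N (t + 1)).toFLMod.prod (tubeBelow N t)).prod D) →ₗ[Λ] (N t).toFLMod),
      IsARSequence f g := by
  obtain ⟨Y, f, g, h⟩ := hN.exists_ar t
  obtain ⟨k, hk⟩ := hN.exists_up t
  obtain ⟨p, hp, -⟩ := h.exists_isSplitEpiMap hk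
  obtain ⟨e⟩ := exists_equiv_prod_ker_of_isSplitEpiMap hp
  let C : FLMod Λ := ⟨LinearMap.ker p⟩
  suffices hC : ∃ D : FLMod Λ, Nonempty (C ≃ₗ[Λ] tubeBelow N t × D) by
    obtain ⟨D, ⟨e'⟩⟩ := hC
    let E : Y ≃ₗ[Λ] (N (t + 1) × tubeBelow N t) × D :=
      e.trans (((LinearEquiv.refl Λ _).prodCongr e').trans (LinearEquiv.prodAssoc Λ _ _ _).symm)
    exact ⟨D, _, _,
      h.congr_middle (Y' := ((N (t + 1)).toFLMod.prod (tubeBelow N t)).prod D) E⟩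
  cases t with
  | zero =>
    have : Unique (tubeBelow N 0) := ⟨⟨0⟩, fun _ => Subsingleton.elim _ _⟩
    exact ⟨C, ⟨LinearEquiv.uniqueProd.symm⟩⟩
  | succ t =>
    obtain ⟨k', hk'⟩ := hN.exists_down t
    obtain ⟨p', ⟨s', hs'⟩, -⟩ := h.exists_isSplitEpiMap hk'
    have hsplit : IsSplitEpiMap (X := (N (t + 1 + 1)).toFLMod.prod C) (Y := (N t).toFLMod)
        ((p' ∘ₗ e.symm.toLinearMap ∘ₗ LinearMap.inl Λ _ _).coprod
          (p' ∘ₗ e.symm.toLinearMap ∘ₗ LinearMap.inr Λ _ _)) := by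
      refine ⟨e.toLinearMap ∘ₗ s', ?_⟩
      rw [← hs', ← LinearMap.comp_coprod, ← LinearMap.comp_coprod, LinearMap.coprod_inl_inr]
      ext x
      simp
    obtain hv := ((N t).indec.isSplitEpiMap_coprod hsplit).resolve_left
      (not_isSplitEpiMap_of_ne hN (by omega) _)
    exact ⟨⟨LinearMap.ker (p' ∘ₗ e.symm.toLinearMap ∘ₗ LinearMap.inr Λ (N (t + 1 + 1)) C)⟩,
      exists_equiv_prod_ker_of_isSplitEpiMap hv⟩

/-- The first differences of a concave sequence of naturals which never takes the same value
twice in a row are positive. -/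
theorem lt_succ_of_concave {a : ℕ → ℕ} (hne : ∀ t, a t ≠ a (t + 1))
    (hc : ∀ t, a (t + 2) + a t ≤ 2 * a (t + 1)) (t : ℕ) : a t < a (t + 1) := by
  by_contra hlt
  have hdesc : ∀ k, a (t + k + 1) < a (t + k) := by
    intro k
    induction k with
    | zero => exact lt_of_le_of_ne (not_lt.mp hlt) (hne t).symm
    | succ k ih =>
      have := hc (t + k)
      have e1 : t + (k + 1) + 1 = t + k + 2 := by ring
      have e2 : t + (k + 1) = t + k + 1 := by ring
      rw [e1, e2]
      omega
  have hbound : ∀ k, a (t + k) + k ≤ a t := by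
    intro k
    induction k with
    | zero => simp
    | succ k ih =>
      have := hdesc k
      have e2 : t + (k + 1) = t + k + 1 := by ring
      rw [e2]
      omega
  have := hbound (a t + 1)
  omega

/-- The Auslander-Reiten sequence `0 → N t → N (t + 1) ⊕ N (t - 1) → N t → 0`, and the resulting
value of the lengths. There is no further summand in the middle, since it would again be a
neighbour of `N t`, and the lengths would not form a strictly increasing sequence. -/
theorem IsTubeSeq.exists_mesh_and_len (hN : IsTubeSeq N) (t : ℕ) :
    (∃ (f : (N t).toFLMod →ₗ[Λ] ((N (t + 1)).toFLMod.prod (tubeBelow N t)))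
      (g : ((N (t + 1)).toFLMod.prod (tubeBelow N t)) →ₗ[Λ] (N t).toFLMod),
      IsARSequence f g) ∧ len Λ (N t) = (t + 1) * len Λ (N 0) := by
  choose D f g h using hN.exists_isARSequence_prod
  have hlen : ∀ t, 2 * len Λ (N t) =
      len Λ (N (t + 1)) + len Λ (tubeBelow N t) + len Λ (D t) := by
    intro t
    have h1 := len_eq_add_of_exact (h t).injective (h t).surjective (h t).exact
    rw [len_prod, len_prod] at h1
    omega
  have hinc : ∀ t, len Λ (N t) < len Λ (N (t + 1)) := by
    refine lt_succ_of_concave (a := fun t => len Λ (N t)) (fun t => ?_) fun t => ?_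
    · obtain ⟨k, hk⟩ := hN.exists_up t
      exact hk.len_ne
    · have := hlen (t + 1)
      have h4 : tubeBelow N (t + 1) = (N t).toFLMod := rfl
      rw [h4] at this
      change _ = len Λ (N (t + 2)) + _ + _ at this
      omega
  have hD : ∀ t, Nontrivial (D t) → ∃ s, len Λ (N s) ≤ len Λ (D t) ∧ (s = t + 1 ∨ t = s + 1) := by
    intro t hnt
    obtain ⟨d, hd⟩ := exists_ne (0 : D t)
    obtain ⟨W, q, hW, hq, -⟩ := exists_indec_summand_apply_ne_zero (Λ := Λ) _ hd
    let W' : IndMod Λ := ⟨⟨W⟩, hW⟩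
    have hq' : (q ∘ₗ LinearMap.snd Λ _ _) ∘ₗ
        (LinearMap.inr Λ (N (t + 1) × tubeBelow N t) (D t) ∘ₗ W.subtype) = LinearMap.id := by
      rw [← hq]
      ext x
      simp
    have hirr := (h t).comp_mem_radHom_notMem_radSqHom (A := W'.toFLMod) (N t).indec
      (N t).indec hW hq'
    obtain ⟨s, ⟨e⟩, hs⟩ := hN.adjacent t W' _ hirr
    refine ⟨s, ?_, hs⟩
    rw [← len_eq_of_equiv e]
    exact len_le_of_injective W.injective_subtype
  have main : ∀ t, Subsingleton (D t) ∧ len Λ (N t) = (t + 1) * len Λ (N 0) ∧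
      len Λ (N (t + 1)) = (t + 2) * len Λ (N 0) := by
    intro t
    induction t with
    | zero =>
      have hsub : Subsingleton (D 0) := by
        by_contra hns
        rw [not_subsingleton_iff_nontrivial] at hns
        obtain ⟨s, hs, rfl | hs'⟩ := hD 0 hns
        · have := hlen 0
          have := hinc 0
          omega
        · omega
      have h1 := hlen 0
      have h2 : len Λ (tubeBelow N 0) = 0 := len_eq_zero_iff.mpr inferInstance
      rw [h2, len_eq_zero_iff.mpr hsub] at h1
      refine ⟨hsub, by ring, ?_⟩
      omega
    | succ t ih =>
      obtain ⟨-, h0, h1⟩ := ih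
      have h2 := hlen (t + 1)
      have h3 := hinc (t + 1)
      have h4 : tubeBelow N (t + 1) = (N t).toFLMod := rfl
      rw [h4] at h2
      have hsub : Subsingleton (D (t + 1)) := by
        by_contra hns
        rw [not_subsingleton_iff_nontrivial] at hns
        obtain ⟨s, hs, rfl | hs'⟩ := hD (t + 1) hns
        · omega
        · obtain rfl : s = t := by omega
          nlinarith
      rw [len_eq_zero_iff.mpr hsub] at h2
      refine ⟨hsub, by rw [h1], ?_⟩
      have : len Λ (N (t + 1 + 1)) + len Λ (N t) = 2 * len Λ (N (t + 1)) := by omega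
      nlinarith
  refine ⟨?_, (main t).2.1⟩
  have := (main t).1
  have : Unique (D t) := ⟨⟨0⟩, fun _ => Subsingleton.elim _ _⟩
  exact ⟨_, _, (h t).congr_middle (Y' := (N (t + 1)).toFLMod.prod (tubeBelow N t))
    LinearEquiv.prodUnique⟩

end Tube

/-! ### Irreducible maps in a homogeneous tube -/

section Squares

variable {Λ : Type u} [Ring Λ] {X A B Z : Type u} [AddCommGroup X] [Module Λ X]
  [AddCommGroup A] [Module Λ A] [AddCommGroup B] [Module Λ B] [AddCommGroup Z] [Module Λ Z]
  {h : X →ₗ[Λ] A} {f : X →ₗ[Λ] B} {g : A →ₗ[Λ] Z} {l : B →ₗ[Λ] Z}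

theorem exact_prod_coprod_apply (he : Function.Exact (h.prod f) (g.coprod l)) (x : X) :
    g (h x) + l (f x) = 0 := by
  simpa using (he (h.prod f x)).mpr ⟨x, rfl⟩

theorem exists_of_exact_prod_coprod (he : Function.Exact (h.prod f) (g.coprod l)) {a : A} {b : B}
    (hab : g a + l b = 0) : ∃ x, h x = a ∧ f x = b := by
  obtain ⟨x, hx⟩ := (he (a, b)).mp (by simpa using hab)
  exact ⟨x, congrArg Prod.fst hx, congrArg Prod.snd hx⟩

/-- In a pushout square, parallel maps have isomorphic cokernels. -/
theorem nonempty_quotient_range_equiv (he : Function.Exact (h.prod f) (g.coprod l))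
    (hs : Function.Surjective (g.coprod l)) :
    Nonempty ((A ⧸ LinearMap.range h) ≃ₗ[Λ] (Z ⧸ LinearMap.range l)) := by
  have hsurj : Function.Surjective ((LinearMap.range l).mkQ ∘ₗ g) := by
    intro z
    obtain ⟨z, rfl⟩ := (LinearMap.range l).mkQ_surjective z
    obtain ⟨⟨a, b⟩, rfl⟩ := hs z
    exact ⟨a, by simp⟩
  have hker : LinearMap.range h = LinearMap.ker ((LinearMap.range l).mkQ ∘ₗ g) := by
    ext a
    simp only [LinearMap.mem_range, LinearMap.mem_ker, LinearMap.comp_apply,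
      Submodule.mkQ_apply, Submodule.Quotient.mk_eq_zero]
    constructor
    · rintro ⟨x, rfl⟩
      exact ⟨-f x, by rw [map_neg, eq_comm, eq_neg_iff_add_eq_zero, exact_prod_coprod_apply he]⟩
    · rintro ⟨b, hb⟩
      obtain ⟨x, hx, -⟩ := exists_of_exact_prod_coprod he (a := a) (b := -b) (by simp [hb])
      exact ⟨x, hx⟩
  exact ⟨(Submodule.quotEquivOfEq _ _ hker).trans (LinearMap.quotKerEquivOfSurjective _ hsurj)⟩

/-- In a pullback square, parallel maps have isomorphic kernels. -/
theorem nonempty_ker_equiv (he : Function.Exact (h.prod f) (g.coprod l))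
    (hi : Function.Injective (h.prod f)) :
    Nonempty (LinearMap.ker f ≃ₗ[Λ] LinearMap.ker g) := by
  let r : LinearMap.ker f →ₗ[Λ] LinearMap.ker g :=
    (h.domRestrict (LinearMap.ker f)).codRestrict (LinearMap.ker g) fun x => by
      have := exact_prod_coprod_apply he (x : X)
      rw [LinearMap.mem_ker.mp x.2, map_zero, add_zero] at this
      simpa using this
  refine ⟨LinearEquiv.ofBijective r ⟨fun x y hxy => ?_, fun a => ?_⟩⟩
  · refine Subtype.ext (hi (Prod.ext (congrArg Subtype.val hxy) ?_))
    simp [LinearMap.mem_ker.mp x.2, LinearMap.mem_ker.mp y.2]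
  · obtain ⟨x, hx, hx'⟩ := exists_of_exact_prod_coprod he (a := (a : A)) (b := 0)
      (by simp [LinearMap.mem_ker.mp a.2])
    exact ⟨⟨x, hx'⟩, Subtype.ext hx⟩

end Squares

section Tube

variable {Λ : Type u} [Ring Λ] {N : ℕ → IndMod Λ}

theorem IsARSequence.irreducible_of_prod {X A B Z : FLMod Λ} {h : X →ₗ[Λ] A} {f : X →ₗ[Λ] B}
    {g : A →ₗ[Λ] Z} {l : B →ₗ[Λ] Z}
    (har : IsARSequence (Y := A.prod B) (h.prod f) (g.coprod l)) (hX : IsIndec Λ X)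
    (hZ : IsIndec Λ Z) (hB : IsIndec Λ B) :
    (f ∈ radHom X B ∧ f ∉ radSqHom X B) ∧ (l ∈ radHom B Z ∧ l ∉ radSqHom B Z) := by
  have h1 := har.comp_mem_radHom_notMem_radSqHom hX hZ hB (LinearMap.snd_comp_inr Λ A B)
  have h2 := har.comp_mem_radHom_notMem_radSqHom' hX hZ hB (LinearMap.snd_comp_inr Λ A B)
  rw [LinearMap.snd_prod] at h1
  rw [LinearMap.coprod_inr] at h2
  exact ⟨h1, h2⟩

theorem IsIndec.isSplitMonoMap_prod {A C E : FLMod Λ} (hE : IsIndec Λ E) {u : E →ₗ[Λ] A}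
    {v : E →ₗ[Λ] C} (h : IsSplitMonoMap (Y := A.prod C) (u.prod v)) :
    IsSplitMonoMap u ∨ IsSplitMonoMap v := by
  by_contra! hno
  rw [← mem_radHom_iff_not_isSplitMonoMap hE, ← mem_radHom_iff_not_isSplitMonoMap hE] at hno
  have h1 := add_mem_radHom_of_isIndec_left (Y := A.prod C) hE
    (radHom_comp_left hno.1 (LinearMap.inl Λ A C))
    (radHom_comp_left hno.2 (LinearMap.inr Λ A C))
  rw [mem_radHom_iff_not_isSplitMonoMap hE] at h1
  refine h1 ?_
  convert h using 1
  ext x <;> simp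

theorem IsTubeSeq.not_isSplitEpiMap_tubeBelow (hN : IsTubeSeq N) (t : ℕ)
    (v : tubeBelow N t →ₗ[Λ] (N (t + 1)).toFLMod) : ¬ IsSplitEpiMap v := by
  cases t with
  | zero =>
    rintro ⟨s, hs⟩
    have := (N 1).indec.1
    obtain ⟨x, hx⟩ := exists_ne (0 : N 1)
    refine hx ?_
    have h1 : v (s x) = x := LinearMap.congr_fun hs x
    rw [← h1, Subsingleton.elim (s x) 0, map_zero]
  | succ t => exact not_isSplitEpiMap_of_ne hN (by omega) v

theorem IsTubeSeq.not_isSplitMonoMap_tubeBelow (hN : IsTubeSeq N) (t : ℕ)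
    (v : (N (t + 1)).toFLMod →ₗ[Λ] tubeBelow N t) : ¬ IsSplitMonoMap v := by
  rintro ⟨r, hr⟩
  exact hN.not_isSplitEpiMap_tubeBelow t r ⟨v, hr⟩

/-- Every irreducible map `N t → N (t + 1)` is a component of the first map of an
Auslander-Reiten sequence. -/
theorem IsTubeSeq.exists_isARSequence_of_up (hN : IsTubeSeq N) {t : ℕ}
    {h : N t →ₗ[Λ] N (t + 1)} (hh : IsIrreducibleMap h) :
    ∃ (f : (N t).toFLMod →ₗ[Λ] tubeBelow N t) (g : N (t + 1) →ₗ[Λ] N t)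
      (l : tubeBelow N t →ₗ[Λ] (N t).toFLMod),
      IsARSequence (X := (N t).toFLMod) (Y := (N (t + 1)).toFLMod.prod (tubeBelow N t))
        (Z := (N t).toFLMod) (h.prod f) (g.coprod l) := by
  obtain ⟨⟨F, G, hFG⟩, -⟩ := hN.exists_mesh_and_len t
  obtain ⟨k, hk, rfl⟩ := hFG.exists_isSplitEpiMap hh
  have hsplit : IsSplitEpiMap (X := (N (t + 1)).toFLMod.prod (tubeBelow N t))
      ((k ∘ₗ LinearMap.inl Λ _ _).coprod (k ∘ₗ LinearMap.inr Λ _ _)) := by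
    rwa [← LinearMap.comp_coprod, LinearMap.coprod_inl_inr]
  obtain ⟨s, hs⟩ := ((N (t + 1)).indec.isSplitEpiMap_coprod hsplit).resolve_right
    (hN.not_isSplitEpiMap_tubeBelow t _)
  have := (N (t + 1)).indec.1
  have hu := (N (t + 1)).indec.bijective_of_comp_eq_id hs
  have hinj : Function.Injective (k.prod (LinearMap.snd Λ (N (t + 1)) (tubeBelow N t))) := by
    rw [← LinearMap.ker_eq_bot, LinearMap.ker_eq_bot']
    rintro ⟨a, b⟩ hab
    obtain rfl : b = 0 := congrArg Prod.snd hab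
    have h1 : k (a, 0) = 0 := congrArg Prod.fst hab
    have h2 : a = 0 := hu.1 (h1.trans (map_zero _).symm)
    rw [h2]
    rfl
  let θ := LinearEquiv.ofBijective _ ⟨hinj, surjective_of_injective_of_len_le hinj le_rfl⟩
  refine ⟨LinearMap.snd Λ _ _ ∘ₗ F, G ∘ₗ θ.symm.toLinearMap ∘ₗ LinearMap.inl Λ _ _,
    G ∘ₗ θ.symm.toLinearMap ∘ₗ LinearMap.inr Λ _ _, ?_⟩
  have h3 := hFG.congr_middle (Y' := (N (t + 1)).toFLMod.prod (tubeBelow N t)) θ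
  rw [← LinearMap.comp_coprod, ← LinearMap.comp_coprod, LinearMap.coprod_inl_inr]
  exact h3

/-- Every irreducible map `N (t + 1) → N t` is a component of the second map of an
Auslander-Reiten sequence. -/
theorem IsTubeSeq.exists_isARSequence_of_down (hN : IsTubeSeq N) {t : ℕ}
    {g : N (t + 1) →ₗ[Λ] N t} (hg : IsIrreducibleMap g) :
    ∃ (h : N t →ₗ[Λ] N (t + 1)) (f : (N t).toFLMod →ₗ[Λ] tubeBelow N t)
      (l : tubeBelow N t →ₗ[Λ] (N t).toFLMod),
      IsARSequence (X := (N t).toFLMod) (Y := (N (t + 1)).toFLMod.prod (tubeBelow N t))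
        (Z := (N t).toFLMod) (h.prod f) (g.coprod l) := by
  obtain ⟨⟨F, G, hFG⟩, -⟩ := hN.exists_mesh_and_len t
  obtain ⟨k, hk, rfl⟩ := hFG.exists_isSplitMonoMap hg
  have hsplit : IsSplitMonoMap (Y := (N (t + 1)).toFLMod.prod (tubeBelow N t))
      ((LinearMap.fst Λ _ _ ∘ₗ k).prod (LinearMap.snd Λ _ _ ∘ₗ k)) := hk
  obtain ⟨r, hr⟩ := ((N (t + 1)).indec.isSplitMonoMap_prod hsplit).resolve_right
    (hN.not_isSplitMonoMap_tubeBelow t _)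
  have := (N (t + 1)).indec.1
  have hu := (N (t + 1)).indec.bijective_of_comp_eq_id' hr
  have hinj : Function.Injective
      (k.coprod (LinearMap.inr Λ (N (t + 1)) (tubeBelow N t))) := by
    rw [← LinearMap.ker_eq_bot, LinearMap.ker_eq_bot']
    rintro ⟨a, b⟩ hab
    have h1 : (k a).1 = 0 := by simpa using congrArg Prod.fst hab
    obtain rfl : a = 0 := hu.1 (h1.trans (map_zero _).symm)
    have h2 : b = 0 := by simpa using congrArg Prod.snd hab
    rw [h2]
    rfl
  let θ := LinearEquiv.ofBijective _ ⟨hinj, surjective_of_injective_of_len_le hinj le_rfl⟩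
  refine ⟨LinearMap.fst Λ _ _ ∘ₗ θ.symm.toLinearMap ∘ₗ F,
    LinearMap.snd Λ _ _ ∘ₗ θ.symm.toLinearMap ∘ₗ F, G ∘ₗ LinearMap.inr Λ _ _, ?_⟩
  have h3 := hFG.congr_middle (Y' := (N (t + 1)).toFLMod.prod (tubeBelow N t)) θ.symm
  rw [← LinearMap.comp_coprod]
  exact h3

/-- Irreducible maps `N t → N (t + 1)` are injective with cokernel `N 0`. -/
theorem IsTubeSeq.injective_of_up (hN : IsTubeSeq N) {t : ℕ} {h : N t →ₗ[Λ] N (t + 1)}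
    (hh : IsIrreducibleMap h) : Function.Injective h ∧
      Nonempty ((N (t + 1) ⧸ LinearMap.range h) ≃ₗ[Λ] N 0) := by
  induction t with
  | zero =>
    obtain ⟨f, g, l, har⟩ := hN.exists_isARSequence_of_up hh
    refine ⟨fun x y hxy => har.injective (Prod.ext hxy (Subsingleton.elim _ _)), ?_⟩
    obtain ⟨e⟩ := nonempty_quotient_range_equiv har.exact har.surjective
    have h0 : LinearMap.range l = ⊥ := by
      rw [LinearMap.range_eq_bot]
      ext x
      rw [Subsingleton.elim x 0, map_zero, map_zero]
    exact ⟨e.trans (Submodule.quotEquivOfEqBot _ h0)⟩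
  | succ t ih =>
    obtain ⟨f, g, l, har⟩ := hN.exists_isARSequence_of_up hh
    have hl := (har.irreducible_of_prod (N (t + 1)).indec (N (t + 1)).indec (N t).indec).2
    obtain ⟨hinj, ⟨e'⟩⟩ := ih (h := l) hl
    obtain ⟨e⟩ := nonempty_quotient_range_equiv har.exact har.surjective
    refine ⟨?_, ⟨e.trans e'⟩⟩
    rw [← LinearMap.ker_eq_bot, LinearMap.ker_eq_bot']
    intro x hx
    have h1 := exact_prod_coprod_apply har.exact x
    rw [hx, map_zero, zero_add] at h1
    have h2 : f x = 0 := (map_eq_zero_iff _ hinj).mp h1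
    exact har.injective (Prod.ext (hx.trans (map_zero _).symm) (h2.trans (map_zero _).symm))

/-- Irreducible maps `N (t + 1) → N t` are surjective with kernel `N 0`. -/
theorem IsTubeSeq.surjective_of_down (hN : IsTubeSeq N) {t : ℕ} {g : N (t + 1) →ₗ[Λ] N t}
    (hg : IsIrreducibleMap g) : Function.Surjective g ∧
      Nonempty (LinearMap.ker g ≃ₗ[Λ] N 0) := by
  induction t with
  | zero =>
    obtain ⟨h, f, l, har⟩ := hN.exists_isARSequence_of_down hg
    obtain ⟨e⟩ := nonempty_ker_equiv har.exact har.injective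
    have h0 : LinearMap.ker f = ⊤ := by
      rw [LinearMap.ker_eq_top]
      ext x
      exact Subsingleton.elim _ _
    refine ⟨fun z => ?_, ⟨e.symm.trans (LinearEquiv.ofTop _ h0)⟩⟩
    obtain ⟨⟨a, b⟩, hz⟩ := har.surjective z
    refine ⟨a, ?_⟩
    rw [← hz, Subsingleton.elim b 0]
    simp
  | succ t ih =>
    obtain ⟨h, f, l, har⟩ := hN.exists_isARSequence_of_down hg
    have hf := (har.irreducible_of_prod (N (t + 1)).indec (N (t + 1)).indec (N t).indec).1
    obtain ⟨hsurj, ⟨e'⟩⟩ := ih (g := f) hf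
    obtain ⟨e⟩ := nonempty_ker_equiv har.exact har.injective
    refine ⟨fun z => ?_, ⟨e.symm.trans e'⟩⟩
    obtain ⟨⟨a, b⟩, rfl⟩ := har.surjective z
    obtain ⟨y, rfl⟩ := hsurj b
    have h1 := exact_prod_coprod_apply har.exact y
    refine ⟨a - h y, ?_⟩
    rw [map_sub, LinearMap.coprod_apply, sub_eq_add_neg, ← eq_neg_of_add_eq_zero_right h1]
    rfl

theorem IsTubeSeq.not_isSplitEpiMap_of_len_le (hN : IsTubeSeq N) {V : FLMod Λ}
    (hV : len Λ V ≤ len Λ (N 0)) (hV0 : ¬ Nonempty (V ≃ₗ[Λ] N 0)) {t : ℕ}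
    (φ : V →ₗ[Λ] (N t).toFLMod) : ¬ IsSplitEpiMap φ := by
  rintro ⟨s, hs⟩
  have hsurj : Function.Surjective φ := fun y => ⟨s y, LinearMap.congr_fun hs y⟩
  have h1 := len_le_of_surjective hsurj
  have h2 := (hN.exists_mesh_and_len t).2
  have := (N 0).indec.1
  have h3 : 0 < len Λ (N 0) := len_pos
  obtain rfl : t = 0 := by nlinarith
  exact hV0 ⟨LinearEquiv.ofBijective φ ⟨injective_of_surjective_of_len_le hsurj hV, hsurj⟩⟩

/-- Maps into `N t` from a module which is not longer than `N 0`, nor isomorphic to it, lift along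
every irreducible map `N (t + 1) → N t`: the Auslander-Reiten property lifts such a map to
`N (t + 1) ⊕ N (t - 1)`, and the second component is lifted to `N t` by induction. -/
theorem IsTubeSeq.exists_lift (hN : IsTubeSeq N) {V : FLMod Λ} (hV : len Λ V ≤ len Λ (N 0))
    (hV0 : ¬ Nonempty (V ≃ₗ[Λ] N 0)) {t : ℕ} {g : N (t + 1) →ₗ[Λ] N t}
    (hg : IsIrreducibleMap g) (φ : V →ₗ[Λ] N t) : ∃ ψ : V →ₗ[Λ] N (t + 1), g ∘ₗ ψ = φ := by
  induction t with
  | zero =>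
    obtain ⟨h, f, l, har⟩ := hN.exists_isARSequence_of_down hg
    obtain ⟨ψ, hψ⟩ := har.right_almost_split V φ (hN.not_isSplitEpiMap_of_len_le hV hV0 φ)
    refine ⟨LinearMap.fst Λ _ _ ∘ₗ ψ, ?_⟩
    rw [← hψ]
    ext x
    have : (ψ x).2 = 0 := Subsingleton.elim _ _
    simp [this]
  | succ t ih =>
    obtain ⟨h, f, l, har⟩ := hN.exists_isARSequence_of_down hg
    have hf := (har.irreducible_of_prod (N (t + 1)).indec (N (t + 1)).indec (N t).indec).1
    obtain ⟨ψ, hψ⟩ := har.right_almost_split V φ (hN.not_isSplitEpiMap_of_len_le hV hV0 φ)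
    obtain ⟨χ, hχ⟩ := ih (g := f) hf (LinearMap.snd Λ _ _ ∘ₗ ψ)
    refine ⟨LinearMap.fst Λ _ _ ∘ₗ ψ - h ∘ₗ χ, ?_⟩
    rw [← hψ]
    ext x
    have h1 := exact_prod_coprod_apply har.exact (χ x)
    have h2 : f (χ x) = (ψ x).2 := LinearMap.congr_fun hχ x
    rw [h2] at h1
    simp only [LinearMap.comp_apply, LinearMap.sub_apply, LinearMap.fst_apply, map_sub,
      LinearMap.coprod_apply]
    rw [sub_eq_add_neg, ← eq_neg_of_add_eq_zero_right h1]

end Tube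

/-! ### Gabriel-Roiter filtrations -/

section Filtrations

variable {Λ : Type u} [Ring Λ]

theorem len_eq_len_ker_add_len_map {X Y : Type u} [AddCommGroup X] [Module Λ X]
    [IsNoetherian Λ X] [IsArtinian Λ X] [AddCommGroup Y] [Module Λ Y] [IsNoetherian Λ Y]
    [IsArtinian Λ Y] (ρ : X →ₗ[Λ] Y) {V : Submodule Λ X} (h : LinearMap.ker ρ ≤ V) :
    len Λ V = len Λ (LinearMap.ker ρ) + len Λ (V.map ρ) := by
  refine len_eq_add_of_exact (f := Submodule.inclusion h) (g := ρ.submoduleMap V)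
    (Submodule.inclusion_injective h) (ρ.submoduleMap_surjective V) fun v => ?_
  constructor
  · intro hv
    have : ρ v = 0 := congrArg Subtype.val hv
    exact ⟨⟨v, this⟩, rfl⟩
  · rintro ⟨w, rfl⟩
    exact Subtype.ext (LinearMap.mem_ker.mp w.2)

theorem hasFiltrationBy_one_of_equiv {X Y : Type u} [AddCommGroup X] [Module Λ X]
    [AddCommGroup Y] [Module Λ Y] (e : X ≃ₗ[Λ] Y) : HasFiltrationBy Λ X Y 1 := by
  refine ⟨![⊥, ⊤], rfl, rfl, fun i => ?_⟩
  obtain rfl : i = 0 := Subsingleton.elim _ _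
  refine ⟨bot_le, ⟨?_⟩⟩
  have h : (⊥ : Submodule Λ X).submoduleOf ⊤ = ⊥ := by simp [Submodule.submoduleOf]
  exact (Submodule.quotEquivOfEqBot _ h).trans (Submodule.topEquiv.trans e)

/-- A filtration of a factor module `X'` of `X` lifts to `X`, the kernel giving a further
factor. -/
theorem HasFiltrationBy.succ {X X' Y : Type u} [AddCommGroup X] [Module Λ X] [AddCommGroup X']
    [Module Λ X'] [AddCommGroup Y] [Module Λ Y] {n : ℕ} (h : HasFiltrationBy Λ X' Y n)
    {q : X →ₗ[Λ] X'} (hq : Function.Surjective q) (e : LinearMap.ker q ≃ₗ[Λ] Y) :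
    HasFiltrationBy Λ X Y (n + 1) := by
  obtain ⟨F, h0, h1, hF⟩ := h
  refine ⟨Fin.cons ⊥ fun i => (F i).comap q, rfl, ?_, fun i => ?_⟩
  · rw [← Fin.succ_last, Fin.cons_succ, h1, Submodule.comap_top]
  · induction i using Fin.cases with
    | zero =>
      have hk : (F 0).comap q = LinearMap.ker q := by
        rw [h0]
        rfl
      have hb : (⊥ : Submodule Λ X).submoduleOf ((F 0).comap q) = ⊥ := Submodule.ker_subtype _
      exact ⟨bot_le, ⟨((Submodule.quotEquivOfEqBot _ hb).trans (LinearEquiv.ofEq _ _ hk)).trans e⟩⟩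
    | succ i =>
      obtain ⟨hle, ⟨e'⟩⟩ := hF i
      let r : (F i.succ).comap q →ₗ[Λ] F i.succ :=
        q.restrict fun x hx => hx
      have hr : Function.Surjective (((F i.castSucc).submoduleOf (F i.succ)).mkQ ∘ₗ r) := by
        refine (Submodule.mkQ_surjective _).comp ?_
        rintro ⟨y, hy⟩
        obtain ⟨x, rfl⟩ := hq y
        exact ⟨⟨x, hy⟩, rfl⟩
      have hk : ((F i.castSucc).comap q).submoduleOf ((F i.succ).comap q) =
          LinearMap.ker (((F i.castSucc).submoduleOf (F i.succ)).mkQ ∘ₗ r) := by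
        rw [LinearMap.ker_comp, Submodule.ker_mkQ]
        rfl
      exact ⟨Submodule.comap_mono hle, ⟨((Submodule.quotEquivOfEq _ _ hk).trans
        (LinearMap.quotKerEquivOfSurjective _ hr)).trans e'⟩⟩

variable {X : Type u} [AddCommGroup X] [Module Λ X] [IsNoetherian Λ X] [IsArtinian Λ X]

theorem isGRInclusion_iff {A B : Submodule Λ X} :
    IsGRInclusion A B ↔ A ≤ B ∧ IsIndec Λ B ∧ IsIndec Λ A ∧
      grMeasure Λ B - grMeasure Λ A = (1 / 2 : ℝ) ^ len Λ B := by
  refine and_congr_right fun h => and_congr_right fun _ => ?_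
  have e := Submodule.submoduleOfEquivOfLe h
  rw [isIndec_congr e, grMeasure_congr _ _ e]

theorem IsGRInclusion.lt {A B : Submodule Λ X} (h : IsGRInclusion A B) : A < B := by
  refine lt_of_le_of_ne h.1 ?_
  rintro rfl
  have h1 := (isGRInclusion_iff.mp h).2.2.2
  rw [sub_self] at h1
  have : (0 : ℝ) < (1 / 2) ^ len Λ A := by positivity
  linarith

theorem IsGRFiltration.strictMono {n : ℕ} {F : Fin (n + 1) → Submodule Λ X}
    (hF : IsGRFiltration F) : StrictMono F :=
  Fin.strictMono_iff_lt_succ.mpr fun i => (hF.incl i).lt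

/-- If all terms of a Gabriel-Roiter filtration after `F i` have length greater than `L`, then
`μ(X)` and `μ(F i)` differ only in binary digits after the `L`-th one. -/
theorem IsGRFiltration.grMeasure_lt {n : ℕ} {F : Fin (n + 1) → Submodule Λ X}
    (hF : IsGRFiltration F) {L : ℕ} {i : Fin (n + 1)} (hi : ∀ j, i < j → L < len Λ (F j)) :
    grMeasure Λ X < grMeasure Λ (F i) + (1 / 2) ^ L := by
  have key : ∀ j, i < j →
      grMeasure Λ (F j) ≤ grMeasure Λ (F i) + (1 / 2) ^ L - (1 / 2) ^ len Λ (F j) := by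
    intro j
    induction j using Fin.induction with
    | zero => intro h; exact absurd h (Fin.not_lt_zero i)
    | succ k ih =>
      intro hk
      have h1 := (isGRInclusion_iff.mp (hF.incl k)).2.2.2
      have h2 : ∀ {a b : ℕ}, a < b → 2 * (1 / 2 : ℝ) ^ b ≤ (1 / 2) ^ a := by
        intro a b hab
        have : (1 / 2 : ℝ) ^ b ≤ (1 / 2) ^ (a + 1) :=
          pow_le_pow_of_le_one (by norm_num) (by norm_num) hab
        rw [pow_succ] at this
        linarith
      rcases (Fin.le_castSucc_iff.mpr hk).eq_or_lt with rfl | hlt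
      · have := h2 (hi _ hk)
        linarith
      · have h3 := ih hlt
        have hle : F k.castSucc ≠ F k.succ := (hF.incl k).lt.ne
        have hll : len Λ (F k.castSucc) < len Λ (F k.succ) := by
          by_contra! hc
          exact hle (eq_of_le_of_len_le (hF.incl k).1 hc)
        have := h2 hll
        linarith
  have htop : grMeasure Λ (F (Fin.last n)) = grMeasure Λ X := by
    rw [hF.last]
    exact grMeasure_congr _ _ Submodule.topEquiv
  rcases (Fin.le_last i).eq_or_lt with rfl | hlt
  · rw [htop]
    have : (0 : ℝ) < (1 / 2) ^ L := by positivity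
    linarith
  · have h1 := key _ hlt
    rw [htop] at h1
    have : (0 : ℝ) < (1 / 2) ^ len Λ (F (Fin.last n)) := by positivity
    linarith

/-- A Gabriel-Roiter filtration of a Gabriel-Roiter submodule `A` of `X` extends to one
of `X`. -/
theorem IsGRFiltration.snoc {A : Submodule Λ X} (hA : IsGRSubmodule A) {n : ℕ}
    {F : Fin (n + 1) → Submodule Λ A} (hF : IsGRFiltration F) :
    IsGRFiltration (Fin.snoc (fun i => (F i).map A.subtype) ⊤ :
      Fin (n + 2) → Submodule Λ X) := by
  let e : ∀ B : Submodule Λ A, B ≃ₗ[Λ] B.map A.subtype := fun B =>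
    Submodule.equivMapOfInjective _ A.injective_subtype B
  refine ⟨fun i => ?_, ?_, ?_, fun i => ?_⟩
  · induction i using Fin.lastCases with
    | last =>
      rw [Fin.snoc_last]
      exact hA.1.of_equiv Submodule.topEquiv.symm
    | cast i =>
      rw [Fin.snoc_castSucc]
      exact (hF.indec i).of_equiv (e _)
  · rw [← Fin.castSucc_zero, Fin.snoc_castSucc]
    have := hF.simple
    exact IsSimpleModule.congr (e (F 0)).symm
  · exact Fin.snoc_last _ _
  · rw [isGRInclusion_iff]
    induction i using Fin.lastCases with
    | last =>
      rw [Fin.succ_last, Fin.snoc_last, Fin.snoc_castSucc, hF.last, Submodule.map_top,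
        Submodule.range_subtype]
      exact ⟨le_top, hA.1.of_equiv Submodule.topEquiv.symm, hA.2.1, by
        rw [len_top, grMeasure_congr _ _ (Submodule.topEquiv (R := Λ) (M := X)), hA.2.2]⟩
    | cast i =>
      rw [Fin.succ_castSucc, Fin.snoc_castSucc, Fin.snoc_castSucc]
      obtain ⟨h1, h2, h3, h4⟩ := isGRInclusion_iff.mp (hF.incl i)
      refine ⟨Submodule.map_mono h1, h2.of_equiv (e _), h3.of_equiv (e _), ?_⟩
      rw [← grMeasure_congr _ _ (e (F i.succ)), ← grMeasure_congr _ _ (e (F i.castSucc)),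
        ← len_eq_of_equiv (e (F i.succ)), h4]

theorem exists_isGRFiltration (X : Type u) [AddCommGroup X] [Module Λ X]
    [IsNoetherian Λ X] [IsArtinian Λ X] (hX : IsIndec Λ X) :
    ∃ (n : ℕ) (F : Fin (n + 1) → Submodule Λ X), IsGRFiltration F := by
  by_cases hs : IsSimpleModule Λ X
  · exact ⟨0, fun _ => ⊤, fun _ => hX.of_equiv Submodule.topEquiv.symm,
      IsSimpleModule.congr Submodule.topEquiv, rfl, fun i => i.elim0⟩
  · obtain ⟨A, hA⟩ := hX.exists_isGRSubmodule hs
    have := len_submodule_lt Λ X A hA.ne_top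
    obtain ⟨n, F, hF⟩ := exists_isGRFiltration A hA.2.1
    exact ⟨n + 1, _, hF.snoc hA⟩
termination_by len Λ X

end Filtrations

/-! ### Gabriel-Roiter filtrations in a homogeneous tube -/

section Tube

variable {Λ : Type u} [Ring Λ] {N : ℕ → IndMod Λ}

theorem IsTubeSeq.len_eq (hN : IsTubeSeq N) (t : ℕ) : len Λ (N t) = (t + 1) * len Λ (N 0) :=
  (hN.exists_mesh_and_len t).2

theorem IndMod.len_pos (X : IndMod Λ) : 0 < len Λ X :=
  have := X.indec.1
  _root_.len_pos

theorem IsTubeSeq.hasFiltrationBy (hN : IsTubeSeq N) (t : ℕ) :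
    HasFiltrationBy Λ (N t) (N 0) (t + 1) := by
  induction t with
  | zero => exact hasFiltrationBy_one_of_equiv (LinearEquiv.refl Λ _)
  | succ t ih =>
    obtain ⟨q, hq⟩ := hN.exists_down t
    obtain ⟨hs, ⟨e⟩⟩ := hN.surjective_of_down hq
    exact ih.succ hs e

theorem IsTubeSeq.exists_injective_zero (hN : IsTubeSeq N) (t : ℕ) :
    ∃ f : N 0 →ₗ[Λ] N t, Function.Injective f := by
  induction t with
  | zero => exact ⟨LinearMap.id, Function.injective_id⟩
  | succ t ih =>
    obtain ⟨f, hf⟩ := ih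
    obtain ⟨h, hh⟩ := hN.exists_up t
    exact ⟨h ∘ₗ f, (hN.injective_of_up hh).1.comp hf⟩

/-- Submodules of `N t` of length at most `|N 0|` are cogenerated by `N 0`: unless its image in
`N (t - 1)` is isomorphic to `N 0`, such a submodule embeds into the direct sum of `N 0` and this
image. -/
theorem IsTubeSeq.exists_apply_ne_zero (hN : IsTubeSeq N) {t : ℕ} {V : FLMod Λ}
    {j : V →ₗ[Λ] N t} (hj : Function.Injective j) (hV : len Λ V ≤ len Λ (N 0)) {x : V}
    (hx : x ≠ 0) : ∃ f : V →ₗ[Λ] N 0, f x ≠ 0 := by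
  induction t generalizing V with
  | zero => exact ⟨j, by rwa [Ne, map_eq_zero_iff _ hj]⟩
  | succ t ih =>
    obtain ⟨q, hq⟩ := hN.exists_down t
    obtain ⟨-, ⟨e⟩⟩ := hN.surjective_of_down hq
    let V' : FLMod Λ := ⟨LinearMap.range (q ∘ₗ j)⟩
    have hV' : len Λ V' ≤ len Λ V := len_le_of_surjective (q ∘ₗ j).surjective_rangeRestrict
    by_cases h0 : Nonempty (V' ≃ₗ[Λ] N 0)
    · have hi : Function.Injective (q ∘ₗ j) := by
        have h1 : Function.Injective (q ∘ₗ j).rangeRestrict :=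
          injective_of_surjective_of_len_le (q ∘ₗ j).surjective_rangeRestrict
            (hV.trans (len_eq_of_equiv h0.some).ge)
        exact fun a b hab => h1 (Subtype.ext hab)
      exact ih hi hV hx
    · by_cases hqx : q (j x) = 0
      · obtain ⟨ψ, hψ⟩ := hN.exists_lift (V := V') (hV'.trans hV) h0 hq
          (LinearMap.range (q ∘ₗ j)).subtype
        have hψ' : ∀ v, q (ψ ((q ∘ₗ j).rangeRestrict v)) = q (j v) := fun v =>
          LinearMap.congr_fun hψ ((q ∘ₗ j).rangeRestrict v)
        let r : V →ₗ[Λ] LinearMap.ker q :=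
          (j - ψ ∘ₗ (q ∘ₗ j).rangeRestrict).codRestrict (LinearMap.ker q) fun v => by
            simp [hψ' v]
        refine ⟨e.toLinearMap ∘ₗ r, ?_⟩
        have h1 : (q ∘ₗ j).rangeRestrict x = 0 := Subtype.ext hqx
        have h2 : ((r x : LinearMap.ker q) : N (t + 1)) = j x := by
          change j x - ψ ((q ∘ₗ j).rangeRestrict x) = j x
          rw [h1, map_zero, sub_zero]
        intro h3
        have h4 : r x = 0 := e.injective (h3.trans (map_zero e).symm)
        rw [h4] at h2
        exact hx (hj (by rw [← h2, map_zero]; rfl))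
      · obtain ⟨f, hf⟩ := ih (V := V') (j := (LinearMap.range (q ∘ₗ j)).subtype)
          (Submodule.injective_subtype _) (hV'.trans hV)
          (x := (q ∘ₗ j).rangeRestrict x) (fun h => hqx (congrArg Subtype.val h))
        exact ⟨f ∘ₗ (q ∘ₗ j).rangeRestrict, hf⟩

/-- Every Gabriel-Roiter filtration of `N t` runs through a submodule isomorphic to `N 0`, namely
the largest term `F i` of length at most `|N 0|`: the remaining terms only affect later binary
digits, so `μ(F i) ≥ μ(N 0)`, and `F i` is cogenerated by `N 0`. -/
theorem IsTubeSeq.exists_equiv_of_isGRFiltration (hN : IsTubeSeq N) {t n : ℕ}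
    {F : Fin (n + 1) → Submodule Λ (N t)} (hF : IsGRFiltration F) :
    ∃ i, Nonempty (F i ≃ₗ[Λ] N 0) := by
  have h0 : len Λ (F 0) ≤ len Λ (N 0) := by
    rw [len_eq_one_iff.mpr hF.simple]
    exact (N 0).len_pos
  obtain ⟨i, hi, hmax⟩ := (wellFounded_gt (α := Fin (n + 1))).has_min
    {i | len Λ (F i) ≤ len Λ (N 0)} ⟨0, h0⟩
  have hmax' : ∀ j, i < j → len Λ (N 0) < len Λ (F j) := fun j hj => by
    by_contra! hc
    exact hmax j hc hj
  obtain ⟨f0, hf0⟩ := hN.exists_injective_zero t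
  have h1 : grMeasure Λ (N 0) < grMeasure Λ (F i) + (1 / 2) ^ len Λ (N 0) :=
    (grMeasure_le_of_injective hf0).trans_lt (hF.grMeasure_lt hmax')
  have h2 : grMeasure Λ (N 0) ≤ grMeasure Λ (F i) :=
    le_of_lt_add_two_pow (grMeasure_eq_div _)
      (exists_eq_div_two_pow_of_le hi (grMeasure_eq_div (F i))) le_rfl h1
  obtain ⟨f, hf⟩ := (hF.indec i).exists_injective_of_cogenerated h2 fun x hx =>
    hN.exists_apply_ne_zero (V := ⟨F i⟩) (F i).injective_subtype hi hx
  exact ⟨i, ⟨LinearEquiv.ofBijective f ⟨hf, surjective_of_grMeasure_le (N 0).indec hf h2⟩⟩⟩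

/-- If `N 0` is a brick, all nonzero maps `N 0 → N t` are injective with the same image: they
factor through `N (t - 1)`, since otherwise `N 0` would be a direct summand of `N t`. -/
theorem IsTubeSeq.exists_range_eq (hN : IsTubeSeq N) (hB : IsBrick Λ (N 0)) (t : ℕ) :
    ∃ L : Submodule Λ (N t), ∀ f : N 0 →ₗ[Λ] N t, f ≠ 0 →
      Function.Injective f ∧ LinearMap.range f = L := by
  induction t with
  | zero =>
    refine ⟨⊤, fun f hf => ?_⟩
    have := (Module.End.isUnit_iff f).mp (hB.2 f hf)
    exact ⟨this.1, LinearMap.range_eq_top.mpr this.2⟩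
  | succ t ih =>
    obtain ⟨L, hL⟩ := ih
    obtain ⟨h, hh⟩ := hN.exists_up t
    obtain ⟨hinj, ⟨e⟩⟩ := hN.injective_of_up hh
    refine ⟨L.map h, fun f hf => ?_⟩
    have hle : ∀ x, f x ∈ LinearMap.range h := by
      by_contra! hno
      obtain ⟨x, hx⟩ := hno
      let p : N (t + 1) →ₗ[Λ] N 0 := e.toLinearMap ∘ₗ (LinearMap.range h).mkQ
      have hp : p ∘ₗ f ≠ 0 := fun h0 => by
        have h1 : e ((LinearMap.range h).mkQ (f x)) = 0 := LinearMap.congr_fun h0 x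
        rw [LinearEquiv.map_eq_zero_iff, Submodule.mkQ_apply,
          Submodule.Quotient.mk_eq_zero] at h1
        exact hx h1
      obtain ⟨u, hu⟩ := hB.2 _ hp
      have hr : ((↑u⁻¹ : Module.End Λ (N 0)) ∘ₗ p) ∘ₗ f = LinearMap.id := by
        rw [LinearMap.comp_assoc, ← hu]
        exact u.inv_mul
      have := (N 0).indec.1
      have hb := (N (t + 1)).indec.bijective_of_comp_eq_id' hr
      have h1 := len_eq_of_equiv (LinearEquiv.ofBijective f hb)
      have h2 := hN.len_eq (t + 1)
      have h3 := (N 0).len_pos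
      nlinarith
    let e' := LinearEquiv.ofInjective h hinj
    let f' : N 0 →ₗ[Λ] N t := e'.symm.toLinearMap ∘ₗ f.codRestrict _ hle
    have hf' : h ∘ₗ f' = f := by
      ext x
      have : e' (f' x) = f.codRestrict _ hle x := e'.apply_symm_apply _
      exact congrArg Subtype.val this
    have hne : f' ≠ 0 := by
      intro h0
      rw [h0, LinearMap.comp_zero] at hf'
      exact hf hf'.symm
    obtain ⟨h1, h2⟩ := hL f' hne
    rw [← hf', LinearMap.range_comp, h2]
    exact ⟨hinj.comp h1, rfl⟩

theorem IsTubeSeq.eq_of_equiv_zero (hN : IsTubeSeq N) (hB : IsBrick Λ (N 0)) {t : ℕ}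
    {A B : Submodule Λ (N t)} (a : A ≃ₗ[Λ] N 0) (b : B ≃ₗ[Λ] N 0) : A = B := by
  obtain ⟨L, hL⟩ := hN.exists_range_eq hB t
  have key : ∀ C : Submodule Λ (N t), (C ≃ₗ[Λ] N 0) → C = L := by
    intro C c
    have hi : Function.Injective (C.subtype ∘ₗ c.symm.toLinearMap) :=
      C.injective_subtype.comp c.symm.injective
    have hne : C.subtype ∘ₗ c.symm.toLinearMap ≠ 0 := by
      intro h0
      rw [h0] at hi
      have := (N 0).indec.1
      obtain ⟨x, hx⟩ := exists_ne (0 : N 0)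
      exact hx (hi rfl)
    rw [← (hL _ hne).2, LinearMap.range_comp]
    simp
  rw [key A a, key B b]

/-- The submodules of `N n` with factor modules `N n, N (n - 1), …, N 0, 0`, as iterated kernels
of a family of surjections `q t : N (t + 1) → N t`. The layer with index `n + 1` and all further
ones are `⊤`. -/
def tubeLayer (q : ∀ t, N (t + 1) →ₗ[Λ] N t) : ∀ n, ℕ → Submodule Λ (N n)
  | _, 0 => ⊥
  | 0, _ + 1 => ⊤
  | n + 1, j + 1 => (tubeLayer q n j).comap (q n)

variable {q : ∀ t, N (t + 1) →ₗ[Λ] N t}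

theorem tubeLayer_zero (n : ℕ) : tubeLayer q n 0 = ⊥ := by cases n <;> rfl

theorem tubeLayer_succ_self (n : ℕ) : tubeLayer q n (n + 1) = ⊤ := by
  induction n with
  | zero => rfl
  | succ n ih => rw [tubeLayer, ih, Submodule.comap_top]

theorem tubeLayer_mono_succ (n j : ℕ) : tubeLayer q n j ≤ tubeLayer q n (j + 1) := by
  induction n generalizing j with
  | zero => cases j with
    | zero => exact bot_le
    | succ j => exact le_rfl
  | succ n ih => cases j with
    | zero => exact bot_le
    | succ j => exact Submodule.comap_mono (ih j)

theorem IsTubeSeq.nonempty_tubeLayer_one_equiv (hN : IsTubeSeq N)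
    (hq : ∀ t, IsIrreducibleMap (q t)) (t : ℕ) : Nonempty (tubeLayer q t 1 ≃ₗ[Λ] N 0) := by
  cases t with
  | zero => exact ⟨Submodule.topEquiv⟩
  | succ t =>
    have h : tubeLayer q (t + 1) 1 = LinearMap.ker (q t) := by
      rw [tubeLayer, tubeLayer_zero]
      rfl
    obtain ⟨e⟩ := (hN.surjective_of_down (hq t)).2
    exact ⟨(LinearEquiv.ofEq _ _ h).trans e⟩

/-- The factor module of `N (s + j)` by its `j`-th layer is `N s`; short modules lift along the
projection. -/
theorem IsTubeSeq.exists_projection (hN : IsTubeSeq N) (hq : ∀ t, IsIrreducibleMap (q t))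
    (s j : ℕ) : ∃ ρ : N (s + j) →ₗ[Λ] N s, Function.Surjective ρ ∧
      LinearMap.ker ρ = tubeLayer q (s + j) j ∧
      (tubeLayer q s 1).comap ρ = tubeLayer q (s + j) (j + 1) ∧
      ∀ V : FLMod Λ, len Λ V ≤ len Λ (N 0) → ¬ Nonempty (V ≃ₗ[Λ] N 0) →
        ∀ φ : V →ₗ[Λ] N s, ∃ ψ : V →ₗ[Λ] N (s + j), ρ ∘ₗ ψ = φ := by
  induction j with
  | zero =>
    refine ⟨LinearMap.id, Function.surjective_id, ?_, rfl, fun V _ _ φ => ⟨φ, rfl⟩⟩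
    rw [LinearMap.ker_id, tubeLayer_zero]
  | succ j ih =>
    obtain ⟨ρ, hs, hk, h1, hl⟩ := ih
    refine ⟨ρ ∘ₗ q (s + j), hs.comp (hN.surjective_of_down (hq _)).1, ?_, ?_, ?_⟩
    · rw [LinearMap.ker_comp, hk]
      rfl
    · rw [Submodule.comap_comp, h1]
      rfl
    · intro V hV hV0 φ
      obtain ⟨ψ, rfl⟩ := hl V hV hV0 φ
      obtain ⟨χ, rfl⟩ := hN.exists_lift hV hV0 (hq (s + j)) ψ
      exact ⟨χ, rfl⟩

theorem IsTubeSeq.len_tubeLayer (hN : IsTubeSeq N) (hq : ∀ t, IsIrreducibleMap (q t)) {n j : ℕ}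
    (hj : j ≤ n + 1) : len Λ (tubeLayer q n j) = j * len Λ (N 0) := by
  rcases Nat.le_succ_iff_eq_or_le.mp hj with rfl | hj
  · rw [tubeLayer_succ_self, len_top, hN.len_eq]
  · obtain ⟨s, rfl⟩ := Nat.exists_eq_add_of_le' hj
    obtain ⟨ρ, hs, hk, -⟩ := hN.exists_projection hq s j
    have h1 := len_eq_add_of_exact (f := (LinearMap.ker ρ).subtype)
      (Submodule.injective_subtype _) hs (LinearMap.exact_subtype_ker_map ρ)
    rw [hk, hN.len_eq, hN.len_eq s] at h1
    nlinarith

/-- If `N 0` is a brick, all embeddings `N n → N (n + 1)` identify the layers of `N n` with those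
of `N (n + 1)`: by induction, since the `(j + 1)`-st layer is determined by the unique submodule
isomorphic to `N 0` of the factor module by the `j`-th one. -/
theorem IsTubeSeq.map_tubeLayer (hN : IsTubeSeq N) (hB : IsBrick Λ (N 0))
    (hq : ∀ t, IsIrreducibleMap (q t)) {n : ℕ} {f : N n →ₗ[Λ] N (n + 1)}
    (hf : Function.Injective f) {j : ℕ} (hj : j ≤ n + 1) :
    (tubeLayer q n j).map f = tubeLayer q (n + 1) j := by
  induction j with
  | zero => rw [tubeLayer_zero, tubeLayer_zero, Submodule.map_bot]
  | succ j ih =>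
    have ih := ih (by omega)
    obtain ⟨s, rfl⟩ : ∃ s, n = s + j := Nat.exists_eq_add_of_le' (by omega)
    obtain ⟨ρ', hs', hk', h1', -⟩ := hN.exists_projection hq s j
    obtain ⟨ρ, hk, h1⟩ : ∃ ρ : N (s + j + 1) →ₗ[Λ] N (s + 1),
        LinearMap.ker ρ = tubeLayer q (s + j + 1) j ∧
        (tubeLayer q (s + 1) 1).comap ρ = tubeLayer q (s + j + 1) (j + 1) := by
      obtain ⟨ρ, -, hk, h1, -⟩ := hN.exists_projection hq (s + 1) j
      rw [show s + j + 1 = s + 1 + j by ring]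
      exact ⟨ρ, hk, h1⟩
    obtain ⟨e0⟩ := hN.nonempty_tubeLayer_one_equiv hq s
    obtain ⟨e1⟩ := hN.nonempty_tubeLayer_one_equiv hq (s + 1)
    -- The kernels of `ρ ∘ f` and `ρ'` agree.
    have hker : LinearMap.ker (ρ ∘ₗ f) = LinearMap.ker ρ' := by
      rw [LinearMap.ker_comp, hk, ← ih, Submodule.comap_map_eq_of_injective hf, hk']
    have hsurj : (tubeLayer q (s + j) (j + 1)).map ρ' = tubeLayer q s 1 := by
      rw [← h1', Submodule.map_comap_eq_of_surjective hs']
    have hiso : Nonempty ((tubeLayer q (s + j) (j + 1)).map (ρ ∘ₗ f) ≃ₗ[Λ] N 0) := by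
      let P := tubeLayer q (s + j) (j + 1)
      have hkP : LinearMap.ker ((ρ ∘ₗ f).submoduleMap P) = LinearMap.ker (ρ'.submoduleMap P) := by
        ext x
        have : (x : N (s + j)) ∈ LinearMap.ker (ρ ∘ₗ f) ↔ (x : N (s + j)) ∈ LinearMap.ker ρ' := by
          rw [hker]
        simpa [LinearMap.mem_ker, Subtype.ext_iff] using this
      exact ⟨((LinearMap.quotKerEquivOfSurjective _
        ((ρ ∘ₗ f).submoduleMap_surjective P)).symm.trans
          ((Submodule.quotEquivOfEq _ _ hkP).trans (LinearMap.quotKerEquivOfSurjective _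
            (ρ'.submoduleMap_surjective P)))).trans ((LinearEquiv.ofEq _ _ hsurj).trans e0)⟩
    have heq := hN.eq_of_equiv_zero hB hiso.some e1
    refine eq_of_le_of_len_le ?_ ?_
    · rw [← h1, ← heq, Submodule.map_comp]
      exact Submodule.le_comap_map _ _
    · rw [hN.len_tubeLayer hq (by omega),
        ← len_eq_of_equiv (Submodule.equivMapOfInjective f hf _), hN.len_tubeLayer hq hj]

theorem IsTubeSeq.nonempty_tubeLayer_equiv (hN : IsTubeSeq N) (hB : IsBrick Λ (N 0))
    (hq : ∀ t, IsIrreducibleMap (q t)) {n j : ℕ} (hj : j ≤ n) :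
    Nonempty (tubeLayer q n (j + 1) ≃ₗ[Λ] N j) := by
  induction n with
  | zero =>
    obtain rfl : j = 0 := by omega
    exact ⟨Submodule.topEquiv⟩
  | succ n ih =>
    rcases Nat.le_succ_iff_eq_or_le.mp hj with rfl | hj
    · rw [tubeLayer_succ_self]
      exact ⟨Submodule.topEquiv⟩
    · obtain ⟨e⟩ := ih hj
      obtain ⟨h, hh⟩ := hN.exists_up n
      have hinj := (hN.injective_of_up hh).1
      rw [← hN.map_tubeLayer hB hq hinj (by omega)]
      exact ⟨(Submodule.equivMapOfInjective h hinj _).symm.trans e⟩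

/-- If `N 0` is a brick and a term of a Gabriel-Roiter filtration is a layer, then the next term
is the next layer. Otherwise the `j`-th layer would split off this next term, which exceeds it by
at most `|N 0|`. -/
theorem IsTubeSeq.eq_tubeLayer_succ (hN : IsTubeSeq N) (hB : IsBrick Λ (N 0))
    (hq : ∀ t, IsIrreducibleMap (q t)) {n j r : ℕ} (hj : j ≤ n)
    {F : Fin (r + 1) → Submodule Λ (N n)}
    (hF : IsGRFiltration F) {i : Fin r} (hi : F i.castSucc = tubeLayer q n j) :
    F i.succ = tubeLayer q n (j + 1) := by
  have hpos := (N 0).len_pos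
  have hlj := hN.len_tubeLayer hq (q := q) (n := n) (j := j) (by omega)
  have hlj' := hN.len_tubeLayer hq (q := q) (n := n) (j := j + 1) (by omega)
  -- The next layer is indecomposable, which bounds the measure of `N n` from below.
  have hlen : len Λ (F i.succ) ≤ (j + 1) * len Λ (N 0) := by
    by_contra! hc
    have h1 := hF.grMeasure_lt (i := i.castSucc) (L := (j + 1) * len Λ (N 0)) fun k hk =>
      hc.trans_le (len_mono (hF.strictMono.monotone (Fin.castSucc_lt_iff_succ_le.mp hk)))
    have hind : IsIndec Λ (tubeLayer q n (j + 1)) :=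
      (N j).indec.of_equiv (hN.nonempty_tubeLayer_equiv hB hq hj).some.symm
    have e := Submodule.submoduleOfEquivOfLe (tubeLayer_mono_succ (q := q) n j)
    have hne : (tubeLayer q n j).submoduleOf (tubeLayer q n (j + 1)) ≠ ⊤ := by
      intro h
      have h2 := len_eq_of_equiv e
      rw [h, len_top, hlj, hlj'] at h2
      nlinarith
    have h2 := grMeasure_add_le_of_ne_top hne hind
    have h3 := grMeasure_submodule_le (tubeLayer q n (j + 1))
    rw [grMeasure_congr _ _ e, hlj'] at h2
    rw [hi] at h1
    linarith
  obtain ⟨s, rfl⟩ := Nat.exists_eq_add_of_le' hj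
  obtain ⟨ρ, -, hk, h1, hlift⟩ := hN.exists_projection hq s j
  have hle : LinearMap.ker ρ ≤ F i.succ := by
    rw [hk, ← hi]
    exact (hF.incl i).1
  by_cases h0 : Nonempty ((F i.succ).map ρ ≃ₗ[Λ] N 0)
  · obtain ⟨e1⟩ := hN.nonempty_tubeLayer_one_equiv hq s
    rw [← h1, ← hN.eq_of_equiv_zero hB h0.some e1, Submodule.comap_map_eq_self hle]
  · exfalso
    have hlA : len Λ ((F i.succ).map ρ) ≤ len Λ (N 0) := by
      have := len_eq_len_ker_add_len_map ρ hle
      rw [hk, hlj] at this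
      nlinarith
    obtain ⟨ψ, hψ⟩ := hlift ⟨(F i.succ).map ρ⟩ hlA h0 ((F i.succ).map ρ).subtype
    have hψ' : ∀ a : (F i.succ).map ρ, ρ (ψ a) = a := fun a => LinearMap.congr_fun hψ a
    let σ : F i.succ →ₗ[Λ] F i.castSucc :=
      ((F i.succ).subtype - ψ ∘ₗ ρ.submoduleMap (F i.succ)).codRestrict _ fun v => by
        rw [hi, ← hk, LinearMap.mem_ker, LinearMap.sub_apply, map_sub, LinearMap.comp_apply,
          hψ', sub_eq_zero]
        rfl
    have hσ : σ ∘ₗ Submodule.inclusion (hF.incl i).1 = LinearMap.id := by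
      refine LinearMap.ext fun v => Subtype.ext ?_
      have h2 : ρ.submoduleMap (F i.succ) (Submodule.inclusion (hF.incl i).1 v) = 0 := by
        refine Subtype.ext ?_
        have : (v : N (s + j)) ∈ LinearMap.ker ρ := by
          rw [hk, ← hi]
          exact v.2
        exact this
      change (v : N (s + j)) - ψ (ρ.submoduleMap (F i.succ) (Submodule.inclusion _ v)) = v
      rw [h2, map_zero, sub_zero]
    have := (hF.indec i.castSucc).1
    have hb := (hF.indec i.succ).bijective_of_comp_eq_id' hσ
    have hll := len_eq_of_equiv (LinearEquiv.ofBijective _ hb)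
    exact (hF.incl i).lt.ne (eq_of_le_of_len_le (hF.incl i).1 hll.ge)

theorem IsTubeSeq.exists_eq_tubeLayer (hN : IsTubeSeq N) (hB : IsBrick Λ (N 0))
    (hq : ∀ t, IsIrreducibleMap (q t)) {n j r : ℕ} (hj : j ≤ n)
    {F : Fin (r + 1) → Submodule Λ (N n)}
    (hF : IsGRFiltration F) : ∃ i, F i = tubeLayer q n (j + 1) := by
  induction j with
  | zero =>
    obtain ⟨i, ⟨e⟩⟩ := hN.exists_equiv_of_isGRFiltration hF
    obtain ⟨e1⟩ := hN.nonempty_tubeLayer_one_equiv hq n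
    exact ⟨i, hN.eq_of_equiv_zero hB e e1⟩
  | succ j ih =>
    obtain ⟨i, hi⟩ := ih (by omega)
    induction i using Fin.lastCases with
    | last =>
      exfalso
      rw [hF.last] at hi
      have h1 := hN.len_tubeLayer hq (q := q) (n := n) (j := j + 1) (by omega)
      rw [← hi, len_top, hN.len_eq] at h1
      have := (N 0).len_pos
      nlinarith
    | cast k => exact ⟨k.succ, hN.eq_tubeLayer_succ hB hq hj hF hi⟩

theorem IsTubeSeq.eq_tubeLayer_of_isGRSubmodule (hN : IsTubeSeq N) (hB : IsBrick Λ (N 0))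
    (hq : ∀ t, IsIrreducibleMap (q t)) {n : ℕ} {A : Submodule Λ (N (n + 1))}
    (hA : IsGRSubmodule A) : A = tubeLayer q (n + 1) (n + 1) := by
  obtain ⟨r, F, hF⟩ := exists_isGRFiltration A hA.2.1
  have hG := hF.snoc hA
  obtain ⟨i, hi⟩ := hN.exists_eq_tubeLayer hB hq (Nat.le_succ n) hG
  have hAl : (Fin.snoc (fun i => (F i).map A.subtype) ⊤ : Fin (r + 2) → Submodule Λ (N (n + 1)))
      (Fin.last r).castSucc = A := by
    rw [Fin.snoc_castSucc, hF.last, Submodule.map_top, Submodule.range_subtype]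
  induction i using Fin.lastCases with
  | last =>
    exfalso
    rw [hG.last] at hi
    have h1 := hN.len_tubeLayer hq (q := q) (n := n + 1) (j := n + 1) (by omega)
    rw [← hi, len_top, hN.len_eq] at h1
    have := (N 0).len_pos
    nlinarith
  | cast k =>
    -- The term after the layer is everything, so the layer is the last proper term.
    have h1 := hN.eq_tubeLayer_succ hB hq le_rfl hG hi
    rw [tubeLayer_succ_self] at h1
    have h2 : k = Fin.last r :=
      Fin.succ_injective _ (hG.strictMono.injective (h1.trans hG.last.symm))
    rw [← hi, h2, hAl]

theorem IsTubeSeq.isGRSubmodule_iff (hN : IsTubeSeq N) (hB : IsBrick Λ (N 0))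
    (hq : ∀ t, IsIrreducibleMap (q t)) {n : ℕ} (A : Submodule Λ (N (n + 1))) :
    IsGRSubmodule A ↔ A = tubeLayer q (n + 1) (n + 1) := by
  refine ⟨hN.eq_tubeLayer_of_isGRSubmodule hB hq, ?_⟩
  rintro rfl
  have hs : ¬ IsSimpleModule Λ (N (n + 1)) := by
    rw [← len_eq_one_iff, hN.len_eq]
    have := (N 0).len_pos
    nlinarith
  obtain ⟨A, hA⟩ := (N (n + 1)).indec.exists_isGRSubmodule hs
  rwa [← hN.eq_tubeLayer_of_isGRSubmodule hB hq hA]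

theorem IsTubeSeq.nonempty_equiv_iff (hN : IsTubeSeq N) (hB : IsBrick Λ (N 0))
    (hq : ∀ t, IsIrreducibleMap (q t)) {n : ℕ} (A : Submodule Λ (N (n + 1))) :
    Nonempty (A ≃ₗ[Λ] N n) ↔ A = tubeLayer q (n + 1) (n + 1) := by
  constructor
  · rintro ⟨e⟩
    have h := hN.map_tubeLayer hB hq (f := A.subtype ∘ₗ e.symm.toLinearMap)
      (A.injective_subtype.comp e.symm.injective) le_rfl
    rw [tubeLayer_succ_self, Submodule.map_top, LinearMap.range_comp] at h
    simpa using h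
  · rintro rfl
    exact hN.nonempty_tubeLayer_equiv hB hq (Nat.le_succ n)

end Tube

theorem theoremB (k : Type*) [CommRing k] [IsArtinianRing k]
    {Λ : Type u} [Ring Λ] [Algebra k Λ] [Module.Finite k Λ]
    (T : Set (ARVertex Λ)) (hT : IsHomogeneousTube T)
    (M : ℕ+ → IndMod Λ) (hM : IsTubeLabelling T M) :
    -- the labelling: `M[1]` has smallest length, `M[t]` has a filtration with `t` factors `M[1]`
    ((∀ t : ℕ+, len Λ (M 1) ≤ len Λ (M t)) ∧
      ∀ t : ℕ+, HasFiltrationBy Λ (M t) (M 1) t) ∧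
    ∀ m : ℕ+, 2 ≤ m →
      -- (a)
      (∀ (n : ℕ) (F : Fin (n + 1) → Submodule Λ (M m)), IsGRFiltration F →
        ∃ i, Nonempty (F i ≃ₗ[Λ] M 1)) ∧
      -- (b)
      (IsBrick Λ (M 1) →
        ∃ N : Submodule Λ (M m),
          (∀ N' : Submodule Λ (M m), IsGRSubmodule N' ↔ N' = N) ∧
          (∀ N' : Submodule Λ (M m), Nonempty (N' ≃ₗ[Λ] M (m - 1)) ↔ N' = N)) := by
  have hN := isTubeSeq_of_isTubeLabelling hT.1 hM
  have hsucc : ∀ t : ℕ+, ∃ n : ℕ, t = n.succPNat := fun t =>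
    ⟨t.natPred, (PNat.succPNat_natPred t).symm⟩
  refine ⟨⟨fun t => ?_, fun t => ?_⟩, fun m hm => ⟨fun n F hF => ?_, fun hB => ?_⟩⟩
  · obtain ⟨n, rfl⟩ := hsucc t
    have h1 : len Λ (M n.succPNat) = (n + 1) * len Λ (M 1) := hN.len_eq n
    rw [h1]
    exact Nat.le_mul_of_pos_left _ n.succ_pos
  · obtain ⟨n, rfl⟩ := hsucc t
    exact hN.hasFiltrationBy n
  · obtain ⟨t, rfl⟩ := hsucc m
    exact hN.exists_equiv_of_isGRFiltration hF
  · obtain ⟨n, rfl⟩ : ∃ n : ℕ, m = (n + 1).succPNat := by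
      obtain ⟨t, rfl⟩ := hsucc m
      have h2 : 2 ≤ t + 1 := hm
      exact ⟨t - 1, by congr 1; omega⟩
    have hsub : (n + 1).succPNat - 1 = n.succPNat := by
      refine PNat.eq ?_
      rw [PNat.sub_coe, if_pos (by
        rw [← PNat.coe_lt_coe]
        simp)]
      simp
    rw [hsub]
    choose q hq using hN.exists_down
    exact ⟨tubeLayer (N := fun t => M t.succPNat) q (n + 1) (n + 1),
      hN.isGRSubmodule_iff hB hq, hN.nonempty_equiv_iff hB hq⟩
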